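/- **Setting.** Let $d\ge 2$. A *closed, $(d+1)$-valent, $(d+1)$-colored $d$-dimensional lattice* $\mathcal L$ is a finite regular cell complex (a finite set of cells with dimensions, partially ordered by inclusion) such that: every cell contains a vertex; every edge has exactly two end points; at every vertex there are exactly $d+1$ edges, every $k\le d$ of these edges span exactly one $k$-cell at that vertex, and there are no other cells at the vertex; every closed cell is a ball (it is enough that it has the $\mathbb Z/2$-homology of a ball); and the $d$-cells are colored with $C_0,\dots,C_d$ so that any two different $d$-cells with a common $(d-1)$-cell have different colors. The *colors* of a cell are the colors of the $d$-cells containing it. The *color code* $CC(\mathcal L)$ (with point-like excitations) is the stabilizer group on qubits placed on the vertices of $\mathcal L$ generated by $X(c)=\bigotimes_{v\subset c}X(v)$ for all $d$-cells $c$ and $Z(f)=\bigotimes_{v\subset f}Z(v)$ for all $2$-cells $f$. For $j=1,\dots,d$, the *shrunk lattice* $\mathcal L_j$, obtained by shrinking the $d$-cells of color $C_j$ to points, has as vertices the $d$-cells of $\mathcal L$ of color $C_j$; as edges the edges of $\mathcal L$ with colors $\{C_0,\dots,C_d\}\setminus\{C_j\}$, each end point $u$ of such an edge being attached to the $d$-cell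 of color $C_j$ that contains $u$; and as faces the $2$-cells of $\mathcal L$ with colors $\{C_0,\dots,C_d\}\setminus\{C_j,C_i\}$ for some $i\ne j$, the boundary of a face consisting of those edges of the $2$-cell that are edges of $\mathcal L_j$. The *toric code* $TC(\mathcal L_j)$ is the stabilizer group on qubits placed on the edges of $\mathcal L_j$ generated by $X(v)=\bigotimes_e X(e)^{n(v,e)}$ for all vertices $v$ of $\mathcal L_j$, where $n(v,e)\in\{0,1,2\}$ is the number of ends of $e$ at $v$, and $Z(f)=\bigotimes_{e\subset f}Z(e)$ for all faces $f$ of $\mathcal L_j$. For each $d$-cell $c$ of color $C_0$, with $V_c$ vertices and $E_c$ edges, add $E_c-V_c$ ancilla qubits, and let $\mathcal S$ be the stabilizer group generated by the single-qubit Pauli operators $Z$ on all ancilla qubits. A *Clifford unitary* from one register of qubits to another is a unitary $W$ such that $WPW^\dagger$ is in the Pauli group of the second register for every $P$ in the Pauli group of the first. **Theorem (Equivalence).** There is a Clifford unitary $U$ from the register of the vertices of $\mathcal L$ and the ancilla qubits to the register of the edges of $\mathcal L_1,\dots,\mathcal L_d$ such that $$U\,[\,CC(\mathcal L)\otimes\mathcal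 S\,]\,U^\dagger=\bigotimes_{j=1}^{d}TC(\mathcal L_j)$$ (an equality of groups of operators, signs included). Moreover, $U$ is local: $U=\bigotimes_{c\in\mathcal C_0}U_c$, where $\mathcal C_0$ is the set of $d$-cells of color $C_0$ and $U_c$ is a Clifford unitary from the qubits on the vertices of $c$ and the ancilla qubits of $c$ to the toric code qubits on the edges of $c$. -/

import Mathlib

open scoped Matrix

noncomputable section

/-! ### Registers of qubits, Pauli operators, stabilizer groups -/

/-- Computational basis labels of a register of qubits indexed by `Q`. -/
def Config (Q : Type*) : Type _ := Q → Fin 2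

instance Config.instFinite (Q : Type*) [Finite Q] : Finite (Config Q) :=
  inferInstanceAs (Finite (Q → Fin 2))

instance Config.instFintype (Q : Type*) [Finite Q] : Fintype (Config Q) := Fintype.ofFinite _

instance Config.instDecidableEq (Q : Type*) : DecidableEq (Config Q) := Classical.decEq _

/-- Linear maps from the Hilbert space `(ℂ²)^{⊗ Q}` to `(ℂ²)^{⊗ Q'}`, in the computational bases. -/
abbrev LinOp (Q' Q : Type*) : Type _ := Matrix (Config Q') (Config Q) ℂ

/-- Operators on the Hilbert space `(ℂ²)^{⊗ Q}`. -/
abbrev Op (Q : Type*) : Type _ := LinOp Q Q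

/-- The tensor product `⨂_q M_q` of one-qubit operators. -/
def qubitTensor {Q : Type*} (M : Q → Matrix (Fin 2) (Fin 2) ℂ) : Op Q :=
  Matrix.of fun y x => ∏ᶠ q, M q (y q) (x q)

theorem qubitTensor_mul {Q : Type*} [Finite Q] (M N : Q → Matrix (Fin 2) (Fin 2) ℂ) :
    qubitTensor M * qubitTensor N = qubitTensor fun q => M q * N q := by
  classical
  have := Fintype.ofFinite Q
  ext y x
  simp only [qubitTensor, Matrix.mul_apply, Matrix.of_apply, finprod_eq_prod_of_fintype]
  rw [Finset.prod_univ_sum, Fintype.piFinset_univ]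
  exact Fintype.sum_equiv (show Config Q ≃ (Q → Fin 2) from Equiv.refl _)
    (fun z => (∏ q, M q (y q) (z q)) * ∏ q, N q (z q) (x q))
    (fun z => ∏ q, M q (y q) (z q) * N q (z q) (x q)) fun z => Finset.prod_mul_distrib.symm

theorem qubitTensor_one {Q : Type*} [Finite Q] :
    qubitTensor (fun _ : Q => (1 : Matrix (Fin 2) (Fin 2) ℂ)) = 1 := by
  classical
  have := Fintype.ofFinite Q
  ext y x
  simp only [qubitTensor, Matrix.of_apply, finprod_eq_prod_of_fintype, Matrix.one_apply]
  by_cases h : y = x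
  · subst h; simp
  · rw [if_neg h]
    obtain ⟨q, hq⟩ := Function.ne_iff.mp h
    exact Finset.prod_eq_zero (Finset.mem_univ q) (if_neg hq)

/-- The Pauli matrix `X`. -/
def sigmaX : Matrix (Fin 2) (Fin 2) ℂ := !![0, 1; 1, 0]

/-- The Pauli matrix `Z`. -/
def sigmaZ : Matrix (Fin 2) (Fin 2) ℂ := !![1, 0; 0, -1]

theorem sigmaX_mul_self : sigmaX * sigmaX = 1 := by
  simp [sigmaX, Matrix.one_fin_two]

theorem sigmaZ_mul_self : sigmaZ * sigmaZ = 1 := by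
  simp [sigmaZ, Matrix.one_fin_two]

theorem qubitTensor_pow_mul_self {Q : Type*} [Finite Q] {P : Matrix (Fin 2) (Fin 2) ℂ}
    (hP : P * P = 1) (a : Q → ℕ) :
    (qubitTensor fun q => P ^ a q) * (qubitTensor fun q => P ^ a q) = 1 := by
  rw [qubitTensor_mul, ← qubitTensor_one]
  congr 1
  funext q
  rw [← (Commute.refl P).mul_pow, hP, one_pow]

/-- The operator `⨂_q X^{a q}`. -/
def pauliX {Q : Type*} [Finite Q] (a : Q → ℕ) : (Op Q)ˣ where
  val := qubitTensor fun q => sigmaX ^ a q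
  inv := qubitTensor fun q => sigmaX ^ a q
  val_inv := qubitTensor_pow_mul_self sigmaX_mul_self a
  inv_val := qubitTensor_pow_mul_self sigmaX_mul_self a

/-- The operator `⨂_q Z^{a q}`. -/
def pauliZ {Q : Type*} [Finite Q] (a : Q → ℕ) : (Op Q)ˣ where
  val := qubitTensor fun q => sigmaZ ^ a q
  inv := qubitTensor fun q => sigmaZ ^ a q
  val_inv := qubitTensor_pow_mul_self sigmaZ_mul_self a
  inv_val := qubitTensor_pow_mul_self sigmaZ_mul_self a

/-- The operator `X` on every qubit of `s` (identity elsewhere). -/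
def pauliXOn {Q : Type*} [Finite Q] (s : Set Q) : (Op Q)ˣ := pauliX (s.indicator 1)

/-- The operator `Z` on every qubit of `s` (identity elsewhere). -/
def pauliZOn {Q : Type*} [Finite Q] (s : Set Q) : (Op Q)ˣ := pauliZ (s.indicator 1)

/-- The scalar operator `i · 1`. -/
def phaseI (Q : Type*) [Finite Q] : (Op Q)ˣ :=
  Units.map (algebraMap ℂ (Op Q)).toMonoidHom (Units.mk0 Complex.I Complex.I_ne_zero)

/-- The Pauli group, generated by the phase `i` and the one-qubit operators `X_q`, `Z_q`. -/
def pauliGroup (Q : Type*) [Finite Q] : Subgroup (Op Q)ˣ :=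
  Subgroup.closure
    ({phaseI Q} ∪ Set.range (fun q : Q => pauliXOn {q}) ∪ Set.range (fun q : Q => pauliZOn {q}))

/-- A Clifford unitary between two registers: a unitary which conjugates Pauli operators to
Pauli operators. -/
def IsClifford {Q' Q : Type*} [Finite Q'] [Finite Q] (U : LinOp Q' Q) : Prop :=
  Uᴴ * U = 1 ∧ U * Uᴴ = 1 ∧
    ∀ P ∈ pauliGroup Q, ∃ P' ∈ pauliGroup Q', U * (P : Op Q) * Uᴴ = (P' : Op Q')

/-- `U G U†`, for a set `G` of operators. -/
def conjBy {Q' Q : Type*} [Finite Q'] [Finite Q] (U : LinOp Q' Q) (G : Set (Op Q)) :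
    Set (Op Q') :=
  (fun P => U * P * Uᴴ) '' G

/-- `G ⊗ H`: all operators `P ⊗ R` with `P ∈ G` and `R ∈ H`, on the disjoint union of the two
registers. -/
def groupTensor {Q R : Type*} [Finite Q] [Finite R]
    (G : Subgroup (Op Q)ˣ) (H : Subgroup (Op R)ˣ) : Set (Op (Q ⊕ R)) :=
  {M | ∃ P ∈ G, ∃ T ∈ H, M = Matrix.of fun y x =>
    (P : Op Q) (fun q => y (Sum.inl q)) (fun q => x (Sum.inl q)) *
    (T : Op R) (fun r => y (Sum.inr r)) (fun r => x (Sum.inr r))}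

/-- `⨂_j G_j`: all operators `⨂_j P_j` with `P_j ∈ G_j`, on the disjoint union of the registers. -/
def groupTensorFamily {J : Type*} [Finite J] {Q : J → Type*} [∀ j, Finite (Q j)]
    (G : ∀ j, Subgroup (Op (Q j))ˣ) : Set (Op (Σ j, Q j)) :=
  {M | ∃ P : ∀ j, (Op (Q j))ˣ, (∀ j, P j ∈ G j) ∧ M = Matrix.of fun y x =>
    ∏ᶠ j, (P j : Op (Q j)) (fun q => y ⟨j, q⟩) (fun q => x ⟨j, q⟩)}

/-- `⨂_c U_c`, where `U_c` maps the qubits in the region `A c` of the register `Q` to the qubits in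
the region `B c` of the register `Q'`; meant for regions that partition the two registers. -/
def regionTensor {I Q' Q : Type*} {B : I → Set Q'} {A : I → Set Q}
    (U : ∀ c, LinOp (B c) (A c)) : LinOp Q' Q :=
  Matrix.of fun y x => ∏ᶠ c, U c (fun q => y q) (fun q => x q)

/-! ### The toric code -/

/-- The part of a (not necessarily regular) cell complex that the toric code with qubits on edges
needs: `ends v e` is the number of ends of the edge `e` at the vertex `v` (so it is `2` for a loop),
`sides f e` is the number of times that the boundary of the face `f` runs through `e`. -/
structure TwoComplex (V E F : Type*) where
  ends : V → E → ℕ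
  sides : F → E → ℕ

/-- The stabilizer group of the toric code with qubits on edges, `X`-generators at vertices and
`Z`-generators at faces. -/
def TwoComplex.toricCode {V E F : Type*} [Finite E] (K : TwoComplex V E F) : Subgroup (Op E)ˣ :=
  Subgroup.closure
    (Set.range (fun v : V => pauliX (K.ends v)) ∪ Set.range (fun f : F => pauliZ (K.sides f)))

/-! ### Lattices: finite cell complexes, given by their cells ordered by inclusion -/

/-- The mod-2 cellular boundary of a chain (in a regular complex every `k`-cell occurs exactly once
in the boundary of each `(k+1)`-cell containing it). -/
def cellBoundary {Cell : Type*} [PartialOrder Cell] (dim : Cell → ℕ) (z : Cell → ZMod 2) :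
    Cell → ZMod 2 :=
  fun y => ∑ᶠ (x : Cell) (_ : y ≤ x ∧ dim x = dim y + 1), z x

/-- `z` is a mod-2 `k`-chain of the closed cell `c`. -/
def IsChainIn {Cell : Type*} [PartialOrder Cell] (dim : Cell → ℕ) (c : Cell) (k : ℕ)
    (z : Cell → ZMod 2) : Prop :=
  ∀ x, z x ≠ 0 → x ≤ c ∧ dim x = k

/-- The closed cell `c` has the mod-2 cellular homology of a ball: `H₀ = ℤ/2` and `H_k = 0` for
`k > 0`. Every closed cell that is a topological ball satisfies this. -/
def IsHomologyBall {Cell : Type*} [PartialOrder Cell] (dim : Cell → ℕ) (c : Cell) : Prop :=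
  (∀ z, IsChainIn dim c 0 z → ∑ᶠ x, z x = 0 →
    ∃ w, IsChainIn dim c 1 w ∧ cellBoundary dim w = z) ∧
  ∀ k z, IsChainIn dim c (k + 1) z → cellBoundary dim z = 0 →
    ∃ w, IsChainIn dim c (k + 2) w ∧ cellBoundary dim w = z

/-- A finite `d`-dimensional lattice without boundary that is `(d+1)`-valent and whose `d`-cells are
properly colored with the `d + 1` colors `C_0, …, C_d`. Cells are ordered by inclusion. The space
need not be connected, and it need only be a manifold in the sense of mod-2 homology. -/
structure ColoredLattice (Cell : Type*) [PartialOrder Cell] (d : ℕ) where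
  dim : Cell → ℕ
  /-- Color of the `d`-cells (the values at other cells are irrelevant). -/
  color : Cell → Fin (d + 1)
  /-- Every cell contains a vertex. -/
  exists_vertex : ∀ x, ∃ v, v ≤ x ∧ dim v = 0
  /-- Every edge has two end points. -/
  edge_ends : ∀ e, dim e = 1 → {v | dim v = 0 ∧ v ≤ e}.ncard = 2
  /-- `(d+1)`-valence: at every vertex there are `d + 1` edges, and around the vertex the lattice
  looks like the boundary of a `(d+1)`-dimensional orthant: any `k ≤ d` of the edges span exactly
  one `k`-cell, and there are no other cells at the vertex. -/
  valence : ∀ v, dim v = 0 →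
    ∃ φ : Set.Ici v ≃o {T : Finset (Fin (d + 1)) // T ≠ Finset.univ},
      ∀ x : Set.Ici v, dim x = (φ x).1.card
  /-- Different `d`-cells with a common `(d-1)`-cell have different colors. -/
  color_ne : ∀ c c', dim c = d → dim c' = d → c ≠ c' →
    (∃ f, dim f + 1 = d ∧ f ≤ c ∧ f ≤ c') → color c ≠ color c'
  /-- Closed cells are balls, as far as mod-2 homology can tell. -/
  ball : ∀ c, IsHomologyBall dim c

namespace ColoredLattice

variable {Cell : Type*} [PartialOrder Cell] {d : ℕ} (L : ColoredLattice Cell d)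

/-- The `k`-cells. -/
abbrev CellOfDim (k : ℕ) : Type _ := {x : Cell // L.dim x = k}

/-- The `d`-cells of color `C_i`. -/
abbrev CellOfColor (i : Fin (d + 1)) : Type _ := {c : Cell // L.dim c = d ∧ L.color c = i}

/-- The set of vertices of a cell. -/
def verticesOf (x : Cell) : Set (L.CellOfDim 0) := {v | v.1 ≤ x}

/-- The set of edges of a cell. -/
def edgesOf (x : Cell) : Set (L.CellOfDim 1) := {e | e.1 ≤ x}

/-- The colors of a cell: those of the `d`-cells it belongs to. -/
def colorsOf (x : Cell) : Set (Fin (d + 1)) := {i | ∃ c : L.CellOfColor i, x ≤ c.1}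

/-- The stabilizer group of the color code with point-like excitations: qubits on vertices,
`X`-generators on `d`-cells, `Z`-generators on 2-cells. -/
def colorCode [Finite Cell] : Subgroup (Op (L.CellOfDim 0))ˣ :=
  Subgroup.closure
    (Set.range (fun c : L.CellOfDim d => pauliXOn (L.verticesOf c)) ∪
      Set.range (fun f : L.CellOfDim 2 => pauliZOn (L.verticesOf f)))

/-! Vertices, edges and faces of the shrunk lattice `L_i`. -/

/-- Vertices of `L_i`: (the centers of) the `d`-cells of color `C_i`. -/
abbrev ShrunkVertex (i : Fin (d + 1)) : Type _ := L.CellOfColor i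

/-- Edges of `L_i`: the edges with all colors but `C_i`. -/
abbrev ShrunkEdge (i : Fin (d + 1)) : Type _ := {e : L.CellOfDim 1 // L.colorsOf e.1 = {i}ᶜ}

/-- Faces of `L_i`: the 2-cells with all colors but `C_i` and `C_j`, for any `j ≠ i`. -/
abbrev ShrunkFace (i : Fin (d + 1)) : Type _ :=
  {f : L.CellOfDim 2 // ∃ j, j ≠ i ∧ L.colorsOf f.1 = {i, j}ᶜ}

/-- The shrunk lattice `L_i`. After the `d`-cells of color `C_i` have been shrunk to points, an end
of an edge is at the vertex `c` if it was a vertex of the cell `c`, and of the boundary of a face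
those edges are left that have not been shrunk. -/
def shrunk (i : Fin (d + 1)) : TwoComplex (L.ShrunkVertex i) (L.ShrunkEdge i) (L.ShrunkFace i) where
  ends c e := (L.verticesOf e.1.1 ∩ L.verticesOf c.1).ncard
  sides f := Set.indicator {e | e.1.1 ≤ f.1.1} 1

/-- The ancilla qubits: for each `d`-cell `c` of color `C_0` with `V` vertices and `E` edges there
are `E - V` of them. -/
abbrev Ancilla : Type _ :=
  Σ c : L.CellOfColor 0, Fin ((L.edgesOf c.1).ncard - (L.verticesOf c.1).ncard)

/-- The stabilizer group of the decoupled ancilla qubits, generated by the one-qubit `Z`. -/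
def ancillaGroup [Finite Cell] : Subgroup (Op L.Ancilla)ˣ :=
  Subgroup.closure (Set.range fun a : L.Ancilla => pauliZOn {a})

/-- The qubits of the color code together with the ancillas. -/
abbrev SourceQubit : Type _ := L.CellOfDim 0 ⊕ L.Ancilla

/-- The qubits of the toric codes on `L_1, …, L_d`. -/
abbrev TargetQubit : Type _ := Σ j : Fin d, L.ShrunkEdge j.succ

/-- The qubits on the vertices of the cell `c` and the ancilla qubits belonging to `c`. -/
def sourceRegion (c : L.CellOfColor 0) : Set L.SourceQubit :=
  Sum.inl '' L.verticesOf c.1 ∪ Sum.inr '' {a | a.1 = c}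

/-- The toric code qubits on the edges of the cell `c`. -/
def targetRegion (c : L.CellOfColor 0) : Set L.TargetQubit := {q | q.2.1 ∈ L.edgesOf c.1}

end ColoredLattice

end

/-!
Fix a `d`-cell `c` of color `C_0`. The edges of `c` form a connected graph on its vertices, in
which each edge misses exactly one color `C_j` with `j ≠ 0`, i.e. belongs to exactly one `L_j`.
Let `∂` be the mod-2 incidence matrix of this graph. Send `X(v)` to the product of the `X(e)` over
the edges `e` of `c` at `v`, and accordingly `Z(e)` back to `Z(u) Z(v)` on the two ends of `e`.
Connectedness says that the rows of `∂` satisfy only one relation, that all of them sum to zero.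
So discarding a root vertex and completing the remaining rows to a basis, with one new row per
ancilla and one for the root, turns this prescription into an invertible linear map over `ℤ/2`,
i.e. a CNOT circuit `U_c`; a shear and a Hadamard on the root first make `X(c)`, which `∂` would
send to the identity, a single-qubit `Z`. Up to products of `Z` along cycles of `c`, `U_c` then
sends the `X`-generators and the 2-cell generators to those of the toric codes: by valence, a
2-cell meets `L_j` in a set of edges whose boundary is the set of its vertices. Finally, the
cycles themselves are products of face generators because closed cells have the homology of balls,
so the ambiguity is harmless and both groups agree.
-/

noncomputable section

section PauliOperators

variable {Q Q' Q'' : Type*}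

/-- A basis label of a register, read as a binary vector. -/
def Config.vec : Config Q ≃ (Q → ZMod 2) := Equiv.refl _

/-- The sign `(-1) ^ s` of a bit, as a character, so that products of signs are signs of sums. -/
def binSign : AddChar (ZMod 2) ℂ := AddChar.zmodChar 2 (ζ := -1) (by norm_num)

/-- The operator `⨂_q X ^ a q`, for a binary vector `a`. -/
def xOp [Finite Q] (a : Q → ZMod 2) : (Op Q)ˣ := pauliX fun q => (a q).val

/-- The operator `⨂_q Z ^ b q`, for a binary vector `b`. -/
def zOp [Finite Q] (b : Q → ZMod 2) : (Op Q)ˣ := pauliZ fun q => (b q).val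

/-- The operator that permutes the computational basis by the permutation `f` of binary vectors,
`|x⟩ ↦ |f x⟩`. -/
def permOp (f : (Q → ZMod 2) ≃ (Q' → ZMod 2)) : LinOp Q' Q :=
  (Config.vec.trans (f.trans Config.vec.symm)).symm.toPEquiv.toMatrix

open scoped Classical in
theorem permOp_apply (f : (Q → ZMod 2) ≃ (Q' → ZMod 2)) (y : Config Q') (x : Config Q) :
    permOp f y x = if y.vec = f x.vec then 1 else 0 := by
  rw [permOp, PEquiv.toMatrix_toPEquiv_apply, Pi.single_apply]
  refine if_congr ?_ rfl rfl
  rw [Equiv.eq_symm_apply, eq_comm]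
  rfl

theorem permOp_mul_permOp [Finite Q'] (f : (Q' → ZMod 2) ≃ (Q'' → ZMod 2))
    (g : (Q → ZMod 2) ≃ (Q' → ZMod 2)) : permOp f * permOp g = permOp (g.trans f) := by
  rw [permOp, permOp, ← PEquiv.toMatrix_trans]
  rfl

theorem permOp_refl : permOp (Equiv.refl (Q → ZMod 2)) = 1 :=
  PEquiv.toMatrix_refl

theorem conjTranspose_permOp (f : (Q → ZMod 2) ≃ (Q' → ZMod 2)) :
    (permOp f)ᴴ = permOp f.symm := by
  classical
  ext x y
  simp only [Matrix.conjTranspose_apply, permOp_apply, apply_ite star, star_one, star_zero,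
    Equiv.eq_symm_apply]
  exact if_congr eq_comm rfl rfl

theorem sigmaX_pow_apply (a y x : Fin 2) :
    (sigmaX ^ (a : ℕ)) y x = if y = x + a then 1 else 0 := by
  fin_cases a <;> fin_cases y <;> fin_cases x <;> simp [sigmaX]

theorem sigmaZ_pow_apply (b y x : Fin 2) :
    (sigmaZ ^ (b : ℕ)) y x = if y = x then (-1) ^ ((b * x : Fin 2) : ℕ) else 0 := by
  fin_cases b <;> fin_cases y <;> fin_cases x <;> simp [sigmaZ]

theorem binSign_sum {ι : Type*} (s : Finset ι) (f : ι → ZMod 2) :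
    binSign (∑ i ∈ s, f i) = ∏ i ∈ s, binSign (f i) :=
  map_prod binSign.toMonoidHom (fun i => Multiplicative.ofAdd (f i)) s

theorem xOp_eq_permOp [Finite Q] (a : Q → ZMod 2) :
    (xOp a : Op Q) = permOp (Equiv.addRight a) := by
  classical
  have := Fintype.ofFinite Q
  ext y x
  have h : (xOp a : Op Q) y x = ∏ q, if y.vec q = x.vec q + a q then 1 else 0 :=
    (finprod_eq_prod_of_fintype _).trans
      (Finset.prod_congr rfl fun q _ => sigmaX_pow_apply (a q) (y.vec q) (x.vec q))
  rw [h, Finset.prod_ite_zero, Finset.prod_const_one, permOp_apply]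
  simp only [Finset.mem_univ, forall_const, funext_iff, Equiv.coe_addRight, Pi.add_apply]

theorem zOp_eq_diagonal [Fintype Q] (b : Q → ZMod 2) :
    (zOp b : Op Q) = Matrix.diagonal fun x => binSign (b ⬝ᵥ x.vec) := by
  classical
  ext y x
  have h : (zOp b : Op Q) y x =
      ∏ q, if y.vec q = x.vec q then binSign (b q * x.vec q) else 0 :=
    (finprod_eq_prod_of_fintype _).trans
      (Finset.prod_congr rfl fun q _ => sigmaZ_pow_apply (b q) (y.vec q) (x.vec q))
  rw [h, Finset.prod_ite_zero, ← binSign_sum]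
  simp only [Finset.mem_univ, forall_const, ← funext_iff, Config.vec.injective.eq_iff]
  by_cases hyx : y = x
  · rw [if_pos hyx, hyx, Matrix.diagonal_apply_eq, dotProduct]
  · rw [if_neg hyx, Matrix.diagonal_apply_ne _ hyx]

theorem xOp_add [Finite Q] (a b : Q → ZMod 2) : xOp (a + b) = xOp a * xOp b := by
  ext1
  rw [Units.val_mul, xOp_eq_permOp, xOp_eq_permOp, xOp_eq_permOp, permOp_mul_permOp, add_comm a,
    Equiv.addRight_add]
  rfl

theorem zOp_add [Finite Q] (a b : Q → ZMod 2) : zOp (a + b) = zOp a * zOp b := by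
  have := Fintype.ofFinite Q
  ext1
  simp only [Units.val_mul, zOp_eq_diagonal, Matrix.diagonal_mul_diagonal, add_dotProduct,
    AddChar.map_add_eq_mul]

theorem xOp_zero [Finite Q] : xOp (0 : Q → ZMod 2) = 1 := by
  simpa only [add_zero, left_eq_mul] using xOp_add (0 : Q → ZMod 2) 0

theorem zOp_zero [Finite Q] : zOp (0 : Q → ZMod 2) = 1 := by
  simpa only [add_zero, left_eq_mul] using zOp_add (0 : Q → ZMod 2) 0

end PauliOperators

section PauliGroup

theorem natCast_indicator_one {ι : Type*} (s : Set ι) :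
    (fun i => ((s.indicator 1 i : ℕ) : ZMod 2)) = s.indicator 1 := by
  classical
  funext i
  simp only [Set.indicator_apply, Pi.one_apply, Nat.cast_ite, Nat.cast_one, Nat.cast_zero]

variable {Q : Type*} [Finite Q]

theorem pauliX_eq_xOp (a : Q → ℕ) : pauliX a = xOp fun q => (a q : ZMod 2) := by
  ext1
  simp only [pauliX, xOp, ZMod.val_natCast, ← pow_eq_pow_mod _ ((pow_two _).trans sigmaX_mul_self)]

theorem pauliZ_eq_zOp (a : Q → ℕ) : pauliZ a = zOp fun q => (a q : ZMod 2) := by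
  ext1
  simp only [pauliZ, zOp, ZMod.val_natCast, ← pow_eq_pow_mod _ ((pow_two _).trans sigmaZ_mul_self)]

theorem pauliXOn_eq_xOp (s : Set Q) : pauliXOn s = xOp (s.indicator 1) := by
  rw [pauliXOn, pauliX_eq_xOp, natCast_indicator_one]

theorem pauliZOn_eq_zOp (s : Set Q) : pauliZOn s = zOp (s.indicator 1) := by
  rw [pauliZOn, pauliZ_eq_zOp, natCast_indicator_one]

/-- The binary vectors whose `X`-operators lie in the group `G`. -/
def xVectors (G : Subgroup (Op Q)ˣ) : Submodule (ZMod 2) (Q → ZMod 2) :=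
  AddSubgroup.toZModSubmodule 2
    { carrier := {a | xOp a ∈ G}
      zero_mem' := (xOp_zero (Q := Q) ▸ G.one_mem : xOp 0 ∈ G)
      add_mem' := fun {a b} ha hb => (xOp_add a b ▸ G.mul_mem ha hb : xOp (a + b) ∈ G)
      neg_mem' := fun {a} ha => (ZModModule.neg_eq_self a).symm ▸ ha }

/-- The binary vectors whose `Z`-operators lie in the group `G`. -/
def zVectors (G : Subgroup (Op Q)ˣ) : Submodule (ZMod 2) (Q → ZMod 2) :=
  AddSubgroup.toZModSubmodule 2
    { carrier := {b | zOp b ∈ G}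
      zero_mem' := (zOp_zero (Q := Q) ▸ G.one_mem : zOp 0 ∈ G)
      add_mem' := fun {a b} ha hb => (zOp_add a b ▸ G.mul_mem ha hb : zOp (a + b) ∈ G)
      neg_mem' := fun {a} ha => (ZModModule.neg_eq_self a).symm ▸ ha }

theorem mem_span_indicator_singleton {s : Set Q} {b : Q → ZMod 2} (hb : ∀ q ∉ s, b q = 0) :
    b ∈ Submodule.span (ZMod 2) ((fun q => Set.indicator {q} 1) '' s) := by
  classical
  have := Fintype.ofFinite Q
  have hsum : b = ∑ q, b q • Set.indicator {q} (1 : Q → ZMod 2) := by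
    funext p
    simp only [Finset.sum_apply, Pi.smul_apply, Set.indicator_apply, Set.mem_singleton_iff,
      Pi.one_apply, smul_eq_mul, mul_ite, mul_one, mul_zero, Finset.sum_ite_eq, Finset.mem_univ,
      if_true]
  rw [hsum]
  refine Submodule.sum_mem _ fun q _ => ?_
  by_cases hq : q ∈ s
  · exact Submodule.smul_mem _ _ (Submodule.subset_span ⟨q, hq, rfl⟩)
  · rw [hb q hq, zero_smul]
    exact Submodule.zero_mem _

theorem xOp_mem_pauliGroup (a : Q → ZMod 2) : xOp a ∈ pauliGroup Q := by
  have h := mem_span_indicator_singleton (s := Set.univ) (b := a) fun q hq => absurd trivial hq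
  refine (Submodule.span_le (p := xVectors (pauliGroup Q))).2 ?_ h
  rintro _ ⟨q, -, rfl⟩
  change xOp _ ∈ pauliGroup Q
  rw [← pauliXOn_eq_xOp]
  exact Subgroup.subset_closure (Or.inl (Or.inr ⟨q, rfl⟩))

theorem zOp_mem_pauliGroup (b : Q → ZMod 2) : zOp b ∈ pauliGroup Q := by
  have h := mem_span_indicator_singleton (s := Set.univ) (b := b) fun q hq => absurd trivial hq
  refine (Submodule.span_le (p := zVectors (pauliGroup Q))).2 ?_ h
  rintro _ ⟨q, -, rfl⟩
  change zOp _ ∈ pauliGroup Q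
  rw [← pauliZOn_eq_zOp]
  exact Subgroup.subset_closure (Or.inr ⟨q, rfl⟩)

/-- The stabilizer group of a CSS code, generated by the `X`-operators of the binary vectors in `S`
and the `Z`-operators of those in `T`. -/
def cssGroup (S T : Set (Q → ZMod 2)) : Subgroup (Op Q)ˣ :=
  Subgroup.closure (xOp '' S ∪ zOp '' T)

variable {S T : Set (Q → ZMod 2)}

theorem xOp_mem_cssGroup {a : Q → ZMod 2} (ha : a ∈ Submodule.span (ZMod 2) S) :
    xOp a ∈ cssGroup S T :=
  (Submodule.span_le (p := xVectors (cssGroup S T))).2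
    (fun b hb => Subgroup.subset_closure (Or.inl ⟨b, hb, rfl⟩)) ha

theorem zOp_mem_cssGroup {b : Q → ZMod 2} (hb : b ∈ Submodule.span (ZMod 2) T) :
    zOp b ∈ cssGroup S T :=
  (Submodule.span_le (p := zVectors (cssGroup S T))).2
    (fun b hb => Subgroup.subset_closure (Or.inr ⟨b, hb, rfl⟩)) hb

theorem cssGroup_le {G : Subgroup (Op Q)ˣ} :
    cssGroup S T ≤ G ↔ (∀ a ∈ S, xOp a ∈ G) ∧ ∀ b ∈ T, zOp b ∈ G := by
  rw [cssGroup, Subgroup.closure_le, Set.union_subset_iff, Set.image_subset_iff,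
    Set.image_subset_iff]
  rfl

end PauliGroup

section Conjugation

variable {Q Q' Q'' : Type*} [Finite Q] [Finite Q'] [Finite Q'']

/-- A unitary from one register to another. -/
structure IsUnitary (U : LinOp Q' Q) : Prop where
  conjTranspose_mul_self : Uᴴ * U = 1
  mul_conjTranspose_self : U * Uᴴ = 1

theorem IsUnitary.mul {V : LinOp Q'' Q'} {U : LinOp Q' Q} (hV : IsUnitary V) (hU : IsUnitary U) :
    IsUnitary (V * U) where
  conjTranspose_mul_self := by
    rw [Matrix.conjTranspose_mul, Matrix.mul_assoc, ← Matrix.mul_assoc Vᴴ,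
      hV.conjTranspose_mul_self, Matrix.one_mul, hU.conjTranspose_mul_self]
  mul_conjTranspose_self := by
    rw [Matrix.conjTranspose_mul, Matrix.mul_assoc, ← Matrix.mul_assoc U,
      hU.mul_conjTranspose_self, Matrix.one_mul, hV.mul_conjTranspose_self]

/-- Conjugation by a unitary, as a homomorphism of groups of invertible operators. -/
def conjHom (U : LinOp Q' Q) (hU : IsUnitary U) : (Op Q)ˣ →* (Op Q')ˣ :=
  Units.map
    { toFun := fun P => U * P * Uᴴ
      map_one' := by rw [Matrix.mul_one, hU.mul_conjTranspose_self]
      map_mul' := fun P R => by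
        have h : U * P * Uᴴ * (U * R * Uᴴ) = U * P * (Uᴴ * U) * R * Uᴴ := by
          simp only [Matrix.mul_assoc]
        rw [h, hU.conjTranspose_mul_self, Matrix.mul_one, Matrix.mul_assoc U P R] }

theorem conjBy_image_val {U : LinOp Q' Q} (hU : IsUnitary U) (G : Subgroup (Op Q)ˣ) :
    conjBy U (Units.val '' (G : Set (Op Q)ˣ)) = Units.val '' (G.map (conjHom U hU) : Set _) := by
  rw [conjBy, Subgroup.coe_map, Set.image_image, Set.image_image]
  rfl

/-- `U P = R U`: the map `U` intertwines the operators `P` and `R`. For unitary `U` this says that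
`R` is `U P U†`, but it is easier to check and to compose. -/
def Carries (U : LinOp Q' Q) (P : (Op Q)ˣ) (R : (Op Q')ˣ) : Prop :=
  U * (P : Op Q) = (R : Op Q') * U

theorem Carries.mul {U : LinOp Q' Q} {P₁ P₂ : (Op Q)ˣ} {R₁ R₂ : (Op Q')ˣ} (h₁ : Carries U P₁ R₁)
    (h₂ : Carries U P₂ R₂) : Carries U (P₁ * P₂) (R₁ * R₂) := by
  rw [Carries] at *
  rw [Units.val_mul, Units.val_mul, ← Matrix.mul_assoc, h₁, Matrix.mul_assoc, h₂, Matrix.mul_assoc]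

theorem Carries.comp {V : LinOp Q'' Q'} {U : LinOp Q' Q} {P : (Op Q)ˣ} {R : (Op Q')ˣ}
    {T : (Op Q'')ˣ} (hV : Carries V R T) (hU : Carries U P R) : Carries (V * U) P T := by
  rw [Carries] at *
  rw [Matrix.mul_assoc, hU, ← Matrix.mul_assoc, hV, Matrix.mul_assoc]

theorem Carries.conjHom_eq {U : LinOp Q' Q} (hU : IsUnitary U) {P : (Op Q)ˣ} {R : (Op Q')ˣ}
    (h : Carries U P R) : conjHom U hU P = R := by
  ext1
  change U * (P : Op Q) * Uᴴ = R
  rw [show U * (P : Op Q) = (R : Op Q') * U from h, Matrix.mul_assoc, hU.mul_conjTranspose_self,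
    Matrix.mul_one]

theorem carries_phaseI (U : LinOp Q' Q) : Carries U (phaseI Q) (phaseI Q') := by
  change U * (algebraMap ℂ (Op Q)) Complex.I = (algebraMap ℂ (Op Q')) Complex.I * U
  rw [Algebra.algebraMap_eq_smul_one, Algebra.algebraMap_eq_smul_one, Matrix.mul_smul,
    Matrix.smul_mul, Matrix.mul_one, Matrix.one_mul]

theorem IsUnitary.isClifford {U : LinOp Q' Q} (hU : IsUnitary U)
    (hX : ∀ a, ∃ P ∈ pauliGroup Q', Carries U (xOp a) P)
    (hZ : ∀ b, ∃ P ∈ pauliGroup Q', Carries U (zOp b) P) : IsClifford U := by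
  refine ⟨hU.1, hU.2, fun P hP => ⟨conjHom U hU P, ?_, rfl⟩⟩
  suffices pauliGroup Q ≤ (pauliGroup Q').comap (conjHom U hU) from this hP
  refine (Subgroup.closure_le _).2 ?_
  rintro _ ((rfl | ⟨q, rfl⟩) | ⟨q, rfl⟩)
  · rw [SetLike.mem_coe, Subgroup.mem_comap, (carries_phaseI U).conjHom_eq]
    exact Subgroup.subset_closure (Or.inl (Or.inl rfl))
  · obtain ⟨P, hP, h⟩ := hX (Set.indicator {q} 1)
    simpa only [pauliXOn_eq_xOp, SetLike.mem_coe, Subgroup.mem_comap, h.conjHom_eq] using hP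
  · obtain ⟨P, hP, h⟩ := hZ (Set.indicator {q} 1)
    simpa only [pauliZOn_eq_zOp, SetLike.mem_coe, Subgroup.mem_comap, h.conjHom_eq] using hP

theorem IsClifford.isUnitary {U : LinOp Q' Q} (hU : IsClifford U) : IsUnitary U :=
  ⟨hU.1, hU.2.1⟩

theorem IsClifford.mul {V : LinOp Q'' Q'} {U : LinOp Q' Q} (hV : IsClifford V)
    (hU : IsClifford U) : IsClifford (V * U) := by
  have h := hV.isUnitary.mul hU.isUnitary
  refine ⟨h.1, h.2, fun P hP => ?_⟩
  obtain ⟨R, hR, hPR⟩ := hU.2.2 P hP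
  obtain ⟨T, hT, hRT⟩ := hV.2.2 R hR
  refine ⟨T, hT, ?_⟩
  rw [← hRT, ← hPR, Matrix.conjTranspose_mul]
  simp only [Matrix.mul_assoc]

end Conjugation

section LinearPermutation

variable {Q Q' : Type*}

/-- The inverse transpose of an invertible linear map of coordinate spaces, which is how it acts on
the vectors that represent linear forms; see `contragredient_dotProduct`. -/
def contragredient {R : Type*} [CommRing R] [Fintype Q] [Fintype Q']
    (e : (Q → R) ≃ₗ[R] (Q' → R)) : (Q → R) →ₗ[R] (Q' → R) :=
  open Classical in (LinearMap.toMatrix' e.symm.toLinearMap).vecMulLinear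

theorem contragredient_dotProduct {R : Type*} [CommRing R] [Fintype Q] [Fintype Q']
    (e : (Q → R) ≃ₗ[R] (Q' → R)) (b : Q → R) (x : Q → R) :
    contragredient e b ⬝ᵥ e x = b ⬝ᵥ x := by
  classical
  rw [contragredient, Matrix.vecMulLinear_apply, ← Matrix.dotProduct_mulVec,
    LinearMap.toMatrix'_mulVec, LinearEquiv.coe_coe, e.symm_apply_apply]

theorem contragredient_contragredient_symm {R : Type*} [CommRing R] [Fintype Q] [Fintype Q']
    (e : (Q → R) ≃ₗ[R] (Q' → R)) (b : Q' → R) :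
    contragredient e (contragredient e.symm b) = b := by
  classical
  refine dotProduct_eq _ _ fun y => ?_
  obtain ⟨x, rfl⟩ := e.surjective y
  rw [contragredient_dotProduct]
  simpa only [e.symm_apply_apply] using contragredient_dotProduct e.symm b (e x)

theorem isUnitary_permOp [Finite Q] [Finite Q'] (f : (Q → ZMod 2) ≃ (Q' → ZMod 2)) :
    IsUnitary (permOp f) where
  conjTranspose_mul_self := by
    rw [conjTranspose_permOp, permOp_mul_permOp, Equiv.self_trans_symm, permOp_refl]
  mul_conjTranspose_self := by
    rw [conjTranspose_permOp, permOp_mul_permOp, Equiv.symm_trans_self, permOp_refl]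

variable (e : (Q → ZMod 2) ≃ₗ[ZMod 2] (Q' → ZMod 2))

theorem carries_permOp_xOp [Finite Q] [Finite Q'] (a : Q → ZMod 2) :
    Carries (permOp e.toEquiv) (xOp a) (xOp (e a)) := by
  rw [Carries, xOp_eq_permOp, xOp_eq_permOp, permOp_mul_permOp, permOp_mul_permOp]
  congr 1
  ext1 x
  exact map_add e x a

theorem carries_permOp_zOp [Fintype Q] [Fintype Q'] {b : Q → ZMod 2} {b' : Q' → ZMod 2}
    (h : ∀ x, b' ⬝ᵥ e x = b ⬝ᵥ x) : Carries (permOp e.toEquiv) (zOp b) (zOp b') := by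
  classical
  ext y x
  rw [zOp_eq_diagonal, zOp_eq_diagonal, Matrix.mul_diagonal, Matrix.diagonal_mul, permOp_apply]
  split_ifs with hyx
  · rw [hyx, LinearEquiv.coe_toEquiv, h, one_mul, mul_one]
  · rw [zero_mul, mul_zero]

theorem isClifford_permOp [Finite Q] [Finite Q'] : IsClifford (permOp e.toEquiv) :=
  have := Fintype.ofFinite Q
  have := Fintype.ofFinite Q'
  (isUnitary_permOp _).isClifford
    (fun a => ⟨_, xOp_mem_pauliGroup _, carries_permOp_xOp e a⟩)
    fun b => ⟨_, zOp_mem_pauliGroup _, carries_permOp_zOp e (contragredient_dotProduct e b)⟩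

end LinearPermutation

section Hadamard

variable {Q : Type*} [Finite Q]

/-- The one-qubit Hadamard operator. -/
def hadamard : Matrix (Fin 2) (Fin 2) ℂ := ((√2 : ℝ) : ℂ)⁻¹ • !![1, 1; 1, -1]

theorem hadamard_mul_self : hadamard * hadamard = 1 := by
  have h : (((√2 : ℝ) : ℂ)⁻¹ * ((√2 : ℝ) : ℂ)⁻¹) * 2 = 1 := by
    rw [← mul_inv, ← Complex.ofReal_mul, Real.mul_self_sqrt zero_le_two, Complex.ofReal_ofNat,
      inv_mul_cancel₀ two_ne_zero]
  rw [hadamard, Matrix.smul_mul, Matrix.mul_smul, smul_smul, Matrix.one_fin_two]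
  ext i j
  fin_cases i <;> fin_cases j <;> simp [one_add_one_eq_two, h]

theorem conjTranspose_hadamard : hadamardᴴ = hadamard := by
  ext i j
  fin_cases i <;> fin_cases j <;> simp [hadamard, Matrix.conjTranspose_apply]

theorem hadamard_mul_sigmaX : hadamard * sigmaX = sigmaZ * hadamard := by
  simp [hadamard, sigmaX, sigmaZ]

theorem hadamard_mul_sigmaZ : hadamard * sigmaZ = sigmaX * hadamard := by
  simp [hadamard, sigmaX, sigmaZ]

theorem conjTranspose_qubitTensor (M : Q → Matrix (Fin 2) (Fin 2) ℂ) :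
    (qubitTensor M)ᴴ = qubitTensor fun q => (M q)ᴴ := by
  have := Fintype.ofFinite Q
  ext y x
  simp only [qubitTensor, Matrix.conjTranspose_apply, Matrix.of_apply,
    finprod_eq_prod_of_fintype, star_prod]

open Classical in
/-- Hadamard operators on the qubits of `R`, the identity on the others. -/
def hadamardOn (R : Set Q) : Op Q := qubitTensor fun q => if q ∈ R then hadamard else 1

variable (R : Set Q)

theorem isUnitary_hadamardOn : IsUnitary (hadamardOn R) := by
  have h : hadamardOn R * hadamardOn R = 1 := by
    rw [hadamardOn, qubitTensor_mul, ← qubitTensor_one]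
    congr 1
    funext q
    split_ifs
    exacts [hadamard_mul_self, one_mul 1]
  have h' : (hadamardOn R)ᴴ = hadamardOn R := by
    simp only [hadamardOn, conjTranspose_qubitTensor, apply_ite Matrix.conjTranspose,
      conjTranspose_hadamard, Matrix.conjTranspose_one]
  exact ⟨by rw [h', h], by rw [h', h]⟩

theorem carries_hadamardOn_xOp (a : Q → ZMod 2) :
    Carries (hadamardOn R) (xOp a) (xOp (Rᶜ.indicator a) * zOp (R.indicator a)) := by
  change qubitTensor _ * qubitTensor _ = qubitTensor _ * qubitTensor _ * qubitTensor _
  rw [qubitTensor_mul, qubitTensor_mul, qubitTensor_mul]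
  congr 1
  funext q
  by_cases hq : q ∈ R
  · have h : SemiconjBy hadamard sigmaX sigmaZ := hadamard_mul_sigmaX
    simpa [hq] using (h.pow_right (a q).val).eq
  · simp [hq]

theorem carries_hadamardOn_zOp (b : Q → ZMod 2) :
    Carries (hadamardOn R) (zOp b) (xOp (R.indicator b) * zOp (Rᶜ.indicator b)) := by
  change qubitTensor _ * qubitTensor _ = qubitTensor _ * qubitTensor _ * qubitTensor _
  rw [qubitTensor_mul, qubitTensor_mul, qubitTensor_mul]
  congr 1
  funext q
  by_cases hq : q ∈ R
  · have h : SemiconjBy hadamard sigmaZ sigmaX := hadamard_mul_sigmaZ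
    simpa [hq] using (h.pow_right (b q).val).eq
  · simp [hq]

theorem isClifford_hadamardOn : IsClifford (hadamardOn R) :=
  (isUnitary_hadamardOn R).isClifford
    (fun a => ⟨_, mul_mem (xOp_mem_pauliGroup _) (zOp_mem_pauliGroup _),
      carries_hadamardOn_xOp R a⟩)
    fun b => ⟨_, mul_mem (xOp_mem_pauliGroup _) (zOp_mem_pauliGroup _),
      carries_hadamardOn_zOp R b⟩

end Hadamard

section Regions

variable {I Q Q' Q'' : Type*} {A : I → Set Q} {B : I → Set Q'} {C : I → Set Q''}

/-- For regions that partition an index set, a vector is the same as a family of vectors, one for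
each region. -/
def restrictEquiv (R : Type*) [Semiring R] (hA : ∀ q, ∃! c, q ∈ A c) :
    (Q → R) ≃ₗ[R] ∀ c, A c → R :=
  LinearEquiv.funCongrLeft R R (Set.sigmaEquiv A hA) ≪≫ₗ LinearEquiv.piCurry R fun _ _ => R

/-- The linear equivalence that acts as `e c` from the coordinates in the region `A c` to those in
the region `B c`. -/
def regionEquiv {R : Type*} [Semiring R] (hA : ∀ q, ∃! c, q ∈ A c) (hB : ∀ q, ∃! c, q ∈ B c)
    (e : ∀ c, (A c → R) ≃ₗ[R] (B c → R)) : (Q → R) ≃ₗ[R] (Q' → R) :=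
  restrictEquiv R hA ≪≫ₗ LinearEquiv.piCongrRight e ≪≫ₗ (restrictEquiv R hB).symm

theorem regionEquiv_apply {R : Type*} [Semiring R] (hA : ∀ q, ∃! c, q ∈ A c)
    (hB : ∀ q, ∃! c, q ∈ B c) (e : ∀ c, (A c → R) ≃ₗ[R] (B c → R)) (x : Q → R) {c : I} (q : B c) :
    regionEquiv hA hB e x q = e c (fun p => x p) q := by
  have h : restrictEquiv R hB (regionEquiv hA hB e x) = fun c => e c fun p => x p :=
    (restrictEquiv R hB).apply_symm_apply _
  exact congrFun (congrFun h c) q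

variable [Finite I]

theorem regionTensor_mul [Finite Q'] (hB : ∀ q, ∃! c, q ∈ B c) (V : ∀ c, LinOp (C c) (B c))
    (U : ∀ c, LinOp (B c) (A c)) :
    regionTensor V * regionTensor U = regionTensor fun c => V c * U c := by
  classical
  have := Fintype.ofFinite I
  ext y x
  have h : (regionTensor fun c => V c * U c) y x =
      ∏ c, ∑ z : Config (B c), V c (fun q => y q) z * U c z (fun q => x q) :=
    finprod_eq_prod_of_fintype _
  rw [h, Matrix.mul_apply, Finset.prod_univ_sum, Fintype.piFinset_univ]
  refine Fintype.sum_equiv (show Config Q' ≃ (∀ c, Config (B c)) from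
    (restrictEquiv (ZMod 2) hB).toEquiv) _ _ fun z => ?_
  simp only [regionTensor, Matrix.of_apply, finprod_eq_prod_of_fintype]
  exact Finset.prod_mul_distrib.symm

theorem qubitTensor_eq_regionTensor [Finite Q] (hA : ∀ q, ∃! c, q ∈ A c)
    (M : Q → Matrix (Fin 2) (Fin 2) ℂ) :
    qubitTensor M = regionTensor fun c => qubitTensor fun q : A c => M q := by
  classical
  have := Fintype.ofFinite I
  have := Fintype.ofFinite Q
  ext y x
  have h : (regionTensor fun c => qubitTensor fun q : A c => M q) y x =
      ∏ c, ∏ q : A c, M q (y q) (x q) := by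
    simp only [← finprod_eq_prod_of_fintype]
    rfl
  have h' : qubitTensor M y x = ∏ q, M q (y q) (x q) := finprod_eq_prod_of_fintype _
  rw [h, h', ← Fintype.prod_sigma' fun c (q : A c) => M q (y q) (x q)]
  exact (Fintype.prod_equiv (Set.sigmaEquiv A hA) _ _ fun _ => rfl).symm

theorem hadamardOn_eq_regionTensor [Finite Q] (hA : ∀ q, ∃! c, q ∈ A c) (R : Set Q) :
    hadamardOn R = regionTensor fun c => hadamardOn {q : A c | q.1 ∈ R} :=
  qubitTensor_eq_regionTensor hA _

theorem permOp_regionEquiv (hA : ∀ q, ∃! c, q ∈ A c) (hB : ∀ q, ∃! c, q ∈ B c)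
    (e : ∀ c, (A c → ZMod 2) ≃ₗ[ZMod 2] (B c → ZMod 2)) :
    permOp (regionEquiv hA hB e).toEquiv = regionTensor fun c => permOp (e c).toEquiv := by
  classical
  have := Fintype.ofFinite I
  ext y x
  have h : (regionTensor fun c => permOp (e c).toEquiv) y x =
      ∏ c, if (fun q : B c => y.vec q) = e c (fun p => x.vec p) then 1 else 0 :=
    (finprod_eq_prod_of_fintype _).trans (Finset.prod_congr rfl fun c _ => permOp_apply _ _ _)
  have h' : y.vec = regionEquiv hA hB e x.vec ↔
      ∀ c ∈ Finset.univ, (fun q : B c => y.vec q) = e c (fun p => x.vec p) := by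
    simp only [Finset.mem_univ, forall_const, funext_iff, ← regionEquiv_apply hA hB]
    refine ⟨fun hy c q => hy q, fun hy q => ?_⟩
    obtain ⟨c, hq, -⟩ := hB q
    exact hy c ⟨q, hq⟩
  rw [h, Finset.prod_ite_zero, Finset.prod_const_one, permOp_apply]
  rw [LinearEquiv.coe_toEquiv, propext h']
  congr

end Regions

section SumTensor

variable {Q R : Type*}

/-- The part of a basis label on the first of two registers. -/
def Config.left (y : Config (Q ⊕ R)) : Config Q := fun q => y (Sum.inl q)

/-- The part of a basis label on the second of two registers. -/
def Config.right (y : Config (Q ⊕ R)) : Config R := fun r => y (Sum.inr r)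

theorem Config.left_right_eq_iff {y x : Config (Q ⊕ R)} :
    y.left = x.left ∧ y.right = x.right ↔ y = x :=
  (Equiv.sumArrowEquivProdArrow Q R (Fin 2)).injective.eq_iff.symm.trans Prod.mk_inj |>.symm

variable [Finite Q] [Finite R]

/-- The homomorphism `(P, T) ↦ P ⊗ T` to operators on the union of the two registers. -/
def sumTensorOp : Op Q × Op R →* Op (Q ⊕ R) where
  toFun P := Matrix.of fun y x => P.1 y.left x.left * P.2 y.right x.right
  map_one' := by
    ext y x
    simp only [Matrix.of_apply, Prod.fst_one, Prod.snd_one, Matrix.one_apply,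
      ← Config.left_right_eq_iff (y := y), ite_and, mul_ite, mul_one, mul_zero]
    split_ifs <;> rfl
  map_mul' P T := by
    ext y x
    simp only [Matrix.of_apply, Prod.fst_mul, Prod.snd_mul, Matrix.mul_apply]
    rw [Finset.sum_mul_sum, ← Fintype.sum_prod_type']
    refine Fintype.sum_equiv (show Config Q × Config R ≃ Config (Q ⊕ R) from
      (Equiv.sumArrowEquivProdArrow Q R (Fin 2)).symm) _ _ fun z => ?_
    exact mul_mul_mul_comm _ _ _ _

/-- The homomorphism `(P, T) ↦ P ⊗ T`, restricted to invertible operators. -/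
def sumTensorHom : (Op Q)ˣ × (Op R)ˣ →* (Op (Q ⊕ R))ˣ :=
  (Units.map sumTensorOp).comp MulEquiv.prodUnits.symm.toMonoidHom

theorem groupTensor_eq_image (G : Subgroup (Op Q)ˣ) (H : Subgroup (Op R)ˣ) :
    groupTensor G H = Units.val '' ((G.prod H).map sumTensorHom : Set (Op (Q ⊕ R))ˣ) := by
  ext M
  constructor
  · rintro ⟨P, hP, T, hT, rfl⟩
    exact ⟨_, ⟨(P, T), ⟨hP, hT⟩, rfl⟩, rfl⟩
  · rintro ⟨_, ⟨⟨P, T⟩, ⟨hP, hT⟩, rfl⟩, rfl⟩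
    exact ⟨P, hP, T, hT, rfl⟩

theorem qubitTensor_sum (M : Q ⊕ R → Matrix (Fin 2) (Fin 2) ℂ) (y x : Config (Q ⊕ R)) :
    qubitTensor M y x = qubitTensor (fun q => M (Sum.inl q)) y.left x.left *
      qubitTensor (fun r => M (Sum.inr r)) y.right x.right := by
  have := Fintype.ofFinite Q
  have := Fintype.ofFinite R
  simp only [qubitTensor, Matrix.of_apply, finprod_eq_prod_of_fintype]
  exact Fintype.prod_sum_type _

theorem sumTensorHom_xOp (a : Q → ZMod 2) (b : R → ZMod 2) :
    sumTensorHom (xOp a, xOp b) = xOp (Sum.elim a b) := by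
  ext y x
  exact (qubitTensor_sum (fun q => sigmaX ^ (Sum.elim a b q).val) y x).symm

theorem sumTensorHom_zOp (a : Q → ZMod 2) (b : R → ZMod 2) :
    sumTensorHom (zOp a, zOp b) = zOp (Sum.elim a b) := by
  ext y x
  exact (qubitTensor_sum (fun q => sigmaZ ^ (Sum.elim a b q).val) y x).symm

theorem map_sumTensorHom_cssGroup (S T : Set (Q → ZMod 2)) (S' T' : Set (R → ZMod 2)) :
    ((cssGroup S T).prod (cssGroup S' T')).map sumTensorHom =
      cssGroup ((Sum.elim · 0) '' S ∪ Sum.elim 0 '' S')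
        ((Sum.elim · 0) '' T ∪ Sum.elim 0 '' T') := by
  have hx (a : Q → ZMod 2) : sumTensorHom (xOp a, 1) = xOp (Sum.elim a (0 : R → ZMod 2)) := by
    rw [← xOp_zero, sumTensorHom_xOp]
  have hx' (a : R → ZMod 2) : sumTensorHom (1, xOp a) = xOp (Sum.elim (0 : Q → ZMod 2) a) := by
    rw [← xOp_zero, sumTensorHom_xOp]
  have hz (b : Q → ZMod 2) : sumTensorHom (zOp b, 1) = zOp (Sum.elim b (0 : R → ZMod 2)) := by
    rw [← zOp_zero, sumTensorHom_zOp]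
  have hz' (b : R → ZMod 2) : sumTensorHom (1, zOp b) = zOp (Sum.elim (0 : Q → ZMod 2) b) := by
    rw [← zOp_zero, sumTensorHom_zOp]
  have hG := (cssGroup_le (S := S) (T := T)).1 le_rfl
  have hH := (cssGroup_le (S := S') (T := T')).1 le_rfl
  refine le_antisymm ?_ (cssGroup_le.2 ⟨?_, ?_⟩)
  · rw [Subgroup.map_le_iff_le_comap, Subgroup.prod_le_iff, Subgroup.map_le_iff_le_comap,
      Subgroup.map_le_iff_le_comap, cssGroup_le, cssGroup_le]
    refine ⟨⟨fun a ha => ?_, fun b hb => ?_⟩, fun a ha => ?_, fun b hb => ?_⟩ <;>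
      rw [Subgroup.mem_comap, Subgroup.mem_comap]
    · rw [MonoidHom.inl_apply, hx]
      exact xOp_mem_cssGroup (Submodule.subset_span (Or.inl ⟨a, ha, rfl⟩))
    · rw [MonoidHom.inl_apply, hz]
      exact zOp_mem_cssGroup (Submodule.subset_span (Or.inl ⟨b, hb, rfl⟩))
    · rw [MonoidHom.inr_apply, hx']
      exact xOp_mem_cssGroup (Submodule.subset_span (Or.inr ⟨a, ha, rfl⟩))
    · rw [MonoidHom.inr_apply, hz']
      exact zOp_mem_cssGroup (Submodule.subset_span (Or.inr ⟨b, hb, rfl⟩))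
  · rintro _ (⟨a, ha, rfl⟩ | ⟨a, ha, rfl⟩)
    exacts [⟨_, ⟨hG.1 a ha, one_mem _⟩, hx a⟩, ⟨_, ⟨one_mem _, hH.1 a ha⟩, hx' a⟩]
  · rintro _ (⟨b, hb, rfl⟩ | ⟨b, hb, rfl⟩)
    exacts [⟨_, ⟨hG.2 b hb, one_mem _⟩, hz b⟩, ⟨_, ⟨one_mem _, hH.2 b hb⟩, hz' b⟩]

theorem groupTensor_cssGroup (S T : Set (Q → ZMod 2)) (S' T' : Set (R → ZMod 2)) :
    groupTensor (cssGroup S T) (cssGroup S' T') = Units.val '' (cssGroup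
      ((Sum.elim · 0) '' S ∪ Sum.elim 0 '' S')
      ((Sum.elim · 0) '' T ∪ Sum.elim 0 '' T') : Set (Op (Q ⊕ R))ˣ) := by
  rw [groupTensor_eq_image, map_sumTensorHom_cssGroup]

end SumTensor

section SigmaTensor

variable {J : Type*} {Q : J → Type*}

/-- The part of a basis label on the register `j`. -/
def Config.part (y : Config (Σ j, Q j)) (j : J) : Config (Q j) := fun q => y ⟨j, q⟩

theorem Config.part_eq_iff {y x : Config (Σ j, Q j)} : (∀ j, y.part j = x.part j) ↔ y = x :=
  funext_iff.symm.trans (Equiv.piCurry fun (j : J) (_ : Q j) => Fin 2).injective.eq_iff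

/-- The vector on the union of the registers that is `a` on the register `j` and zero elsewhere. -/
def sigmaSingle [DecidableEq J] (j : J) (a : Q j → ZMod 2) : (Σ j, Q j) → ZMod 2 :=
  fun q => (Pi.single j a : ∀ j, Q j → ZMod 2) q.1 q.2

variable [Finite J] [∀ j, Finite (Q j)]

/-- The homomorphism `P ↦ ⨂_j P_j` to operators on the union of the registers. -/
def sigmaTensorOp : (∀ j, Op (Q j)) →* Op (Σ j, Q j) where
  toFun P := Matrix.of fun y x => ∏ᶠ j, P j (y.part j) (x.part j)
  map_one' := by
    classical
    have := Fintype.ofFinite J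
    ext y x
    simp only [Matrix.of_apply, Pi.one_apply, Matrix.one_apply, finprod_eq_prod_of_fintype]
    rw [Finset.prod_ite_zero, Finset.prod_const_one]
    simp only [Finset.mem_univ, forall_const, Config.part_eq_iff]
  map_mul' P T := by
    classical
    have := Fintype.ofFinite J
    ext y x
    simp only [Matrix.of_apply, Pi.mul_apply, Matrix.mul_apply, finprod_eq_prod_of_fintype]
    rw [Finset.prod_univ_sum, Fintype.piFinset_univ]
    refine Fintype.sum_equiv (show (∀ j, Config (Q j)) ≃ Config (Σ j, Q j) from
      (Equiv.piCurry fun _ _ => Fin 2).symm) _ _ fun z => ?_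
    exact Finset.prod_mul_distrib

/-- The homomorphism `P ↦ ⨂_j P_j`, restricted to invertible operators. -/
def sigmaTensorHom : (∀ j, (Op (Q j))ˣ) →* (Op (Σ j, Q j))ˣ :=
  (Units.map sigmaTensorOp).comp MulEquiv.piUnits.symm.toMonoidHom

theorem groupTensorFamily_eq_image (G : ∀ j, Subgroup (Op (Q j))ˣ) :
    groupTensorFamily G =
      Units.val '' ((Subgroup.pi Set.univ G).map sigmaTensorHom : Set (Op (Σ j, Q j))ˣ) := by
  ext M
  constructor
  · rintro ⟨P, hP, rfl⟩
    exact ⟨_, ⟨P, fun j _ => hP j, rfl⟩, rfl⟩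
  · rintro ⟨_, ⟨P, hP, rfl⟩, rfl⟩
    exact ⟨P, fun j => hP j trivial, rfl⟩

theorem qubitTensor_sigma (M : (Σ j, Q j) → Matrix (Fin 2) (Fin 2) ℂ) (y x : Config (Σ j, Q j)) :
    qubitTensor M y x = ∏ᶠ j, qubitTensor (fun q => M ⟨j, q⟩) (y.part j) (x.part j) := by
  have := Fintype.ofFinite J
  have := fun j => Fintype.ofFinite (Q j)
  simp only [qubitTensor, Matrix.of_apply, finprod_eq_prod_of_fintype]
  exact Fintype.prod_sigma _

theorem sigmaTensorHom_xOp (a : ∀ j, Q j → ZMod 2) :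
    sigmaTensorHom (fun j => xOp (a j)) = xOp fun q => a q.1 q.2 := by
  ext y x
  exact (qubitTensor_sigma (fun q => sigmaX ^ (a q.1 q.2).val) y x).symm

theorem sigmaTensorHom_zOp (b : ∀ j, Q j → ZMod 2) :
    sigmaTensorHom (fun j => zOp (b j)) = zOp fun q => b q.1 q.2 := by
  ext y x
  exact (qubitTensor_sigma (fun q => sigmaZ ^ (b q.1 q.2).val) y x).symm

variable [DecidableEq J]

theorem sigmaTensorHom_mulSingle_xOp (j : J) (a : Q j → ZMod 2) :
    sigmaTensorHom (Pi.mulSingle j (xOp a)) = xOp (sigmaSingle j a) := by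
  refine Eq.trans (congrArg _ ?_) (sigmaTensorHom_xOp _)
  funext i
  obtain rfl | h := eq_or_ne i j
  · rw [Pi.mulSingle_eq_same, Pi.single_eq_same]
  · rw [Pi.mulSingle_eq_of_ne h, Pi.single_eq_of_ne h, xOp_zero]

theorem sigmaTensorHom_mulSingle_zOp (j : J) (b : Q j → ZMod 2) :
    sigmaTensorHom (Pi.mulSingle j (zOp b)) = zOp (sigmaSingle j b) := by
  refine Eq.trans (congrArg _ ?_) (sigmaTensorHom_zOp _)
  funext i
  obtain rfl | h := eq_or_ne i j
  · rw [Pi.mulSingle_eq_same, Pi.single_eq_same]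
  · rw [Pi.mulSingle_eq_of_ne h, Pi.single_eq_of_ne h, zOp_zero]

theorem map_sigmaTensorHom_cssGroup (S T : ∀ j, Set (Q j → ZMod 2)) :
    (Subgroup.pi Set.univ fun j => cssGroup (S j) (T j)).map sigmaTensorHom =
      cssGroup (⋃ j, sigmaSingle j '' S j) (⋃ j, sigmaSingle j '' T j) := by
  have hG (j : J) := (cssGroup_le (S := S j) (T := T j)).1 le_rfl
  refine le_antisymm ?_ (cssGroup_le.2 ⟨?_, ?_⟩)
  · rw [Subgroup.map_le_iff_le_comap, Subgroup.pi_le_iff]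
    intro j
    rw [Subgroup.map_le_iff_le_comap, cssGroup_le]
    refine ⟨fun a ha => ?_, fun b hb => ?_⟩ <;>
      rw [Subgroup.mem_comap, Subgroup.mem_comap, MonoidHom.mulSingle_apply]
    · rw [sigmaTensorHom_mulSingle_xOp]
      exact xOp_mem_cssGroup (Submodule.subset_span (Set.mem_iUnion.2 ⟨j, a, ha, rfl⟩))
    · rw [sigmaTensorHom_mulSingle_zOp]
      exact zOp_mem_cssGroup (Submodule.subset_span (Set.mem_iUnion.2 ⟨j, b, hb, rfl⟩))
  · rintro _ h
    obtain ⟨j, a, ha, rfl⟩ := Set.mem_iUnion.1 h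
    exact ⟨_, (Subgroup.mulSingle_mem_pi _ _).2 fun _ => (hG j).1 a ha,
      sigmaTensorHom_mulSingle_xOp j a⟩
  · rintro _ h
    obtain ⟨j, b, hb, rfl⟩ := Set.mem_iUnion.1 h
    exact ⟨_, (Subgroup.mulSingle_mem_pi _ _).2 fun _ => (hG j).2 b hb,
      sigmaTensorHom_mulSingle_zOp j b⟩

theorem groupTensorFamily_cssGroup (S T : ∀ j, Set (Q j → ZMod 2)) :
    groupTensorFamily (fun j => cssGroup (S j) (T j)) = Units.val '' (cssGroup
      (⋃ j, sigmaSingle j '' S j) (⋃ j, sigmaSingle j '' T j) : Set (Op (Σ j, Q j))ˣ) := by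
  rw [groupTensorFamily_eq_image, map_sigmaTensorHom_cssGroup]

end SigmaTensor

section RootedGraph

theorem exists_basis_eq_of_linearIndepOn {ι K V : Type*} [Finite ι] [Field K] [AddCommGroup V]
    [Module K V] [FiniteDimensional K V] {s : Set ι} {f : ι → V} (hf : LinearIndepOn K f s)
    (h : Nat.card ι = Module.finrank K V) : ∃ b : Module.Basis ι K V, ∀ i ∈ s, b i = f i := by
  classical
  have := Fintype.ofFinite ι
  have hs : LinearIndepOn K id (f '' s) := hf.id_image
  let b := Module.Basis.extend hs
  have := Module.Finite.finite_basis b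
  have := Fintype.ofFinite (hs.extend (Set.subset_univ _))
  have hcard : Fintype.card ι = (hs.extend (Set.subset_univ _)).toFinset.card := by
    rw [Set.toFinset_card, ← Nat.card_eq_fintype_card, h, Module.finrank_eq_card_basis b]
  have hmaps : Set.MapsTo f s (hs.extend (Set.subset_univ _)).toFinset := fun i hi =>
    Set.mem_toFinset.2 (hs.subset_extend _ ⟨i, hi, rfl⟩)
  obtain ⟨g, hg⟩ := hmaps.exists_equiv_extend_of_card_eq hcard hf.injOn
  let e := g.trans (Equiv.subtypeEquivRight fun _ => Set.mem_toFinset)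
  refine ⟨b.reindex e.symm, fun i hi => ?_⟩
  rw [Module.Basis.reindex_apply, Module.Basis.extend_apply_self]
  exact hg i hi

theorem indicator_dotProduct {ι R : Type*} [Fintype ι] [NonUnitalNonAssocSemiring R]
    (s : Set ι) (a b : ι → R) : s.indicator a ⬝ᵥ b = a ⬝ᵥ s.indicator b := by
  refine Finset.sum_congr rfl fun i _ => ?_
  by_cases hi : i ∈ s
  · rw [Set.indicator_of_mem hi, Set.indicator_of_mem hi]
  · rw [Set.indicator_of_notMem hi, Set.indicator_of_notMem hi, zero_mul, mul_zero]

variable {I Q E : Type*}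

/-- A graph cut into connected parts, each with a root, as binary data for a decoding circuit. The
part `c` has its vertices and some spare positions in `source c` and its edges in `target c`, and
there are as many vertices and spare positions as edges. The entries of `incidence` count the ends
of an edge at a vertex modulo two. -/
structure RootedGraph (I Q E : Type*) [Fintype Q] where
  source : I → Set Q
  target : I → Set E
  existsUnique_source : ∀ q, ∃! c, q ∈ source c
  existsUnique_target : ∀ e, ∃! c, e ∈ target c
  card_source : ∀ c, Nat.card (source c) = Nat.card (target c)
  vertices : Set Q
  root : I → Q
  root_mem_source : ∀ c, root c ∈ source c
  root_mem_vertices : ∀ c, root c ∈ vertices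
  incidence : Matrix Q E (ZMod 2)
  incidence_of_notMem_vertices : ∀ q ∉ vertices, incidence q = 0
  mem_source_iff_of_incidence_ne_zero : ∀ {q e c}, incidence q e ≠ 0 →
    (q ∈ source c ↔ e ∈ target c)
  one_vecMul_incidence : 1 ᵥ* incidence = 0
  eq_root_of_vecMul_incidence_eq_zero : ∀ {w c q}, w ᵥ* incidence = 0 → q ∈ source c →
    q ∈ vertices → w q = w (root c)

namespace RootedGraph

variable [Fintype Q] (G : RootedGraph I Q E)

/-- The part of the graph to which a vertex or spare position belongs. -/
def part (q : Q) : I := (G.existsUnique_source q).choose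

theorem mem_source_part (q : Q) : q ∈ G.source (G.part q) :=
  (G.existsUnique_source q).choose_spec.1

theorem part_eq {c : I} {q : Q} (h : q ∈ G.source c) : G.part q = c :=
  (G.existsUnique_source q).unique (G.mem_source_part q) h

/-- The vertices other than the roots. -/
def nonroots : Set Q := G.vertices \ Set.range G.root

theorem eq_root {c : I} {q : Q} (h : q ∈ G.source c) (hq : q ∈ Set.range G.root) :
    q = G.root c := by
  obtain ⟨c', rfl⟩ := hq
  rw [← G.part_eq h, G.part_eq (G.root_mem_source c')]

/-- The function that takes on the vertices of each part the value of `w` at the root. -/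
def spread (w : Q → ZMod 2) : Q → ZMod 2 := G.vertices.indicator fun q => w (G.root (G.part q))

theorem spread_of_notMem {w : Q → ZMod 2} {q : Q} (hq : q ∉ G.vertices) : G.spread w q = 0 :=
  Set.indicator_of_notMem hq _

theorem spread_of_mem {w : Q → ZMod 2} {q : Q} {c : I} (hq : q ∈ G.vertices)
    (hc : q ∈ G.source c) : G.spread w q = w (G.root c) := by
  rw [spread, Set.indicator_of_mem hq, G.part_eq hc]

theorem spread_root (w : Q → ZMod 2) (c : I) : G.spread w (G.root c) = w (G.root c) :=
  G.spread_of_mem (G.root_mem_vertices c) (G.root_mem_source c)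

theorem spread_spread (w : Q → ZMod 2) : G.spread (G.spread w) = G.spread w := by
  rw [spread]
  simp only [spread_root]
  rfl

theorem dotProduct_spread {b : Q → ZMod 2} (hb : ∀ q ∈ G.vertices, b q = 0) (w : Q → ZMod 2) :
    b ⬝ᵥ G.spread w = 0 := by
  refine Finset.sum_eq_zero fun q _ => ?_
  by_cases hq : q ∈ G.vertices
  · rw [hb q hq, zero_mul]
  · rw [G.spread_of_notMem hq, mul_zero]

theorem spread_vecMul_incidence (w : Q → ZMod 2) : G.spread w ᵥ* G.incidence = 0 := by
  funext e
  obtain ⟨c, hc, -⟩ := G.existsUnique_target e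
  have h : ∀ q, G.spread w q * G.incidence q e = w (G.root c) * (1 * G.incidence q e) := by
    intro q
    by_cases hqe : G.incidence q e = 0
    · rw [hqe, mul_zero, mul_zero, mul_zero]
    · have hq : q ∈ G.vertices := by
        by_contra hq
        exact hqe (congrFun (G.incidence_of_notMem_vertices q hq) e)
      rw [G.spread_of_mem hq ((G.mem_source_iff_of_incidence_ne_zero hqe).2 hc), one_mul]
  calc (G.spread w ᵥ* G.incidence) e = ∑ q, w (G.root c) * (1 * G.incidence q e) :=
        Finset.sum_congr rfl fun q _ => h q
    _ = w (G.root c) * (1 ᵥ* G.incidence) e := (Finset.mul_sum _ _ _).symm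
    _ = 0 := by rw [G.one_vecMul_incidence, Pi.zero_apply, mul_zero]

/-- On the part `c`, the linear map that adds the value at the root to all other vertices. -/
def rootShearOn (c : I) : (G.source c → ZMod 2) ≃ₗ[ZMod 2] (G.source c → ZMod 2) :=
  LinearEquiv.transvection (f := LinearMap.proj ⟨G.root c, G.root_mem_source c⟩)
    (v := {q : G.source c | q.1 ∈ G.nonroots}.indicator 1)
    (Set.indicator_of_notMem (fun h => h.2 ⟨c, rfl⟩) _)

/-- The linear map that adds in each part the value at the root to all other vertices. -/
def rootShear : (Q → ZMod 2) ≃ₗ[ZMod 2] (Q → ZMod 2) :=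
  regionEquiv G.existsUnique_source G.existsUnique_source G.rootShearOn

theorem rootShear_apply (w : Q → ZMod 2) :
    G.rootShear w = w + G.spread w + (Set.range G.root).indicator w := by
  funext q
  obtain ⟨c, hc, -⟩ := G.existsUnique_source q
  have h : G.rootShear w q =
      w q + w (G.root c) * Set.indicator {q : G.source c | q.1 ∈ G.nonroots} 1 ⟨q, hc⟩ :=
    regionEquiv_apply G.existsUnique_source G.existsUnique_source G.rootShearOn w ⟨q, hc⟩
  rw [h, Pi.add_apply, Pi.add_apply, add_assoc]
  congr 1
  by_cases hr : q ∈ Set.range G.root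
  · rw [Set.indicator_of_mem hr, Set.indicator_of_notMem fun h => h.2 hr, mul_zero,
      G.eq_root hc hr, spread_root, CharTwo.add_self_eq_zero]
  · rw [Set.indicator_of_notMem hr, add_zero]
    by_cases hq : q ∈ G.vertices
    · have hn : (⟨q, hc⟩ : G.source c) ∈ {q : G.source c | q.1 ∈ G.nonroots} := ⟨hq, hr⟩
      rw [Set.indicator_of_mem hn, Pi.one_apply, mul_one, G.spread_of_mem hq hc]
    · rw [Set.indicator_of_notMem fun h => hq h.1, mul_zero, G.spread_of_notMem hq]

theorem indicator_range_root_rootShear (w : Q → ZMod 2) :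
    (Set.range G.root).indicator (G.rootShear w) = (Set.range G.root).indicator w := by
  refine Set.indicator_congr fun q hq => ?_
  rw [rootShear_apply, Pi.add_apply, Pi.add_apply, Set.indicator_of_mem hq]
  obtain ⟨c, rfl⟩ := hq
  rw [spread_root, CharTwo.add_self_eq_zero, zero_add]

theorem indicator_compl_range_root_rootShear (w : Q → ZMod 2) :
    (Set.range G.root)ᶜ.indicator (G.rootShear w) = w + G.spread w := by
  rw [Set.indicator_compl, indicator_range_root_rootShear, rootShear_apply, add_sub_cancel_right]

theorem indicator_compl_dotProduct_rootShear {s : Q → ZMod 2} (hs : ∀ w, s ⬝ᵥ G.spread w = 0)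
    (x : Q → ZMod 2) : (Set.range G.root)ᶜ.indicator s ⬝ᵥ G.rootShear x = s ⬝ᵥ x := by
  rw [indicator_dotProduct, indicator_compl_range_root_rootShear, dotProduct_add, hs, add_zero]

theorem linearIndepOn_incidence (c : I) :
    LinearIndepOn (ZMod 2) (fun (q : G.source c) (e : G.target c) => G.incidence q e)
      {q | q.1 ∈ G.nonroots} := by
  classical
  have := Fintype.ofFinite {q : G.source c | q.1 ∈ G.nonroots}
  refine Fintype.linearIndependent_iff.2 fun g hg p => ?_
  let i : {q : G.source c | q.1 ∈ G.nonroots} → Q := fun q => q.1.1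
  have hi : Function.Injective i := Subtype.val_injective.comp Subtype.val_injective
  have hw : Function.extend i g 0 ᵥ* G.incidence = 0 := by
    funext e
    have h : (Function.extend i g 0 ᵥ* G.incidence) e = ∑ q, g q * G.incidence (i q) e := by
      refine (Fintype.sum_of_injective i hi _ _ (fun q hq => ?_) fun q => ?_).symm
      · rw [Function.extend_apply' _ _ _ hq, Pi.zero_apply, zero_mul]
      · rw [hi.extend_apply]
    rw [h]
    by_cases he : e ∈ G.target c
    · exact (Finset.sum_apply _ _ _).symm.trans (congrFun hg ⟨e, he⟩)
    · refine Finset.sum_eq_zero fun q _ => ?_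
      have hqe : G.incidence (i q) e = 0 := by
        by_contra hqe
        exact he ((G.mem_source_iff_of_incidence_ne_zero hqe).1 q.1.2)
      rw [hqe, mul_zero]
  have hroot : ¬ ∃ q, i q = G.root c := fun ⟨q, hq⟩ => q.2.2 ⟨c, hq.symm⟩
  calc g p = Function.extend i g 0 (i p) := (hi.extend_apply g 0 p).symm
    _ = Function.extend i g 0 (G.root c) :=
      G.eq_root_of_vecMul_incidence_eq_zero hw p.1.2 p.2.1
    _ = 0 := Function.extend_apply' _ _ _ hroot

end RootedGraph

end RootedGraph

section Unfolding

namespace RootedGraph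

variable {I Q E : Type*} [Fintype Q] [Finite E] (G : RootedGraph I Q E)

theorem exists_basis_incidence (c : I) :
    ∃ b : Module.Basis (G.source c) (ZMod 2) (G.target c → ZMod 2),
      ∀ q ∈ {q : G.source c | q.1 ∈ G.nonroots}, b q = fun e : G.target c => G.incidence q e := by
  have := Fintype.ofFinite (G.target c)
  refine exists_basis_eq_of_linearIndepOn (G.linearIndepOn_incidence c) ?_
  rw [Module.finrank_fintype_fun_eq_card, G.card_source, Nat.card_eq_fintype_card]

/-- On the part `c`, a linear equivalence between the vectors on the vertices and spare positions
and those on the edges, which sends each nonroot vertex to its row of the incidence matrix. -/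
def edgeEquivOn (c : I) : (G.source c → ZMod 2) ≃ₗ[ZMod 2] (G.target c → ZMod 2) :=
  (G.exists_basis_incidence c).choose.equivFun.symm

/-- A linear equivalence between the vectors on the vertices and spare positions and those on the
edges, which sends each nonroot vertex to its row of the incidence matrix; see `edgeEquiv_apply`. -/
def edgeEquiv : (Q → ZMod 2) ≃ₗ[ZMod 2] (E → ZMod 2) :=
  regionEquiv G.existsUnique_source G.existsUnique_target G.edgeEquivOn

theorem edgeEquiv_apply {y : Q → ZMod 2} (hy : ∀ q ∉ G.nonroots, y q = 0) :
    G.edgeEquiv y = y ᵥ* G.incidence := by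
  have := fun c => Fintype.ofFinite (G.source c)
  funext e
  obtain ⟨c, hc, -⟩ := G.existsUnique_target e
  have hterm : ∀ p : G.source c,
      y p * (G.exists_basis_incidence c).choose p ⟨e, hc⟩ = y p * G.incidence p e := by
    intro p
    by_cases hp : p.1 ∈ G.nonroots
    · rw [(G.exists_basis_incidence c).choose_spec p hp]
    · rw [hy p hp, zero_mul, zero_mul]
  calc G.edgeEquiv y e = G.edgeEquivOn c (fun p => y p) ⟨e, hc⟩ :=
        regionEquiv_apply G.existsUnique_source G.existsUnique_target G.edgeEquivOn y ⟨e, hc⟩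
    _ = ∑ p : G.source c, y p * (G.exists_basis_incidence c).choose p ⟨e, hc⟩ := by
        rw [edgeEquivOn, Module.Basis.equivFun_symm_apply, Finset.sum_apply]
        rfl
    _ = ∑ q, y q * G.incidence q e := by
        refine Fintype.sum_of_injective Subtype.val Subtype.val_injective _ _ (fun q hq => ?_) hterm
        have hqe : G.incidence q e = 0 := by
          by_contra hqe
          exact hq ⟨⟨q, (G.mem_source_iff_of_incidence_ne_zero hqe).2 hc⟩, rfl⟩
        rw [hqe, mul_zero]

theorem edgeEquiv_single [DecidableEq Q] {q : Q} (hq : q ∈ G.nonroots) :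
    G.edgeEquiv (Pi.single q 1) = G.incidence q := by
  rw [edgeEquiv_apply, Matrix.single_one_vecMul]
  · rfl
  · exact fun p hp => Pi.single_eq_of_ne (fun h : p = q => hp (h ▸ hq)) 1

/-- The decoding circuit of a rooted graph: add the root to all other vertices of its part, apply a
Hadamard operator to the roots, and replace every nonroot vertex by the edges that end there. -/
def unfolding : LinOp E Q :=
  permOp G.edgeEquiv.toEquiv * hadamardOn (Set.range G.root) * permOp G.rootShear.toEquiv

/-- The factor of `unfolding` that belongs to the part `c`. -/
def unfoldingOn (c : I) : LinOp (G.target c) (G.source c) :=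
  permOp (G.edgeEquivOn c).toEquiv * hadamardOn {q : G.source c | q.1 ∈ Set.range G.root} *
    permOp (G.rootShearOn c).toEquiv

theorem isClifford_unfolding : IsClifford G.unfolding :=
  ((isClifford_permOp _).mul (isClifford_hadamardOn _)).mul (isClifford_permOp _)

theorem isClifford_unfoldingOn (c : I) : IsClifford (G.unfoldingOn c) :=
  ((isClifford_permOp _).mul (isClifford_hadamardOn _)).mul (isClifford_permOp _)

theorem unfolding_eq_regionTensor [Finite I] : G.unfolding = regionTensor G.unfoldingOn := by
  rw [unfolding, edgeEquiv, rootShear, permOp_regionEquiv, permOp_regionEquiv,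
    hadamardOn_eq_regionTensor G.existsUnique_source, regionTensor_mul G.existsUnique_source,
    regionTensor_mul G.existsUnique_source]
  rfl

end RootedGraph

end Unfolding

section Encoding

namespace RootedGraph

variable {I Q E : Type*} [Fintype Q] [Fintype E] (G : RootedGraph I Q E)

theorem carries_unfolding_xOp (w : Q → ZMod 2) :
    Carries G.unfolding (xOp w)
      (xOp (G.edgeEquiv ((Set.range G.root)ᶜ.indicator (G.rootShear w))) *
        zOp (contragredient G.edgeEquiv ((Set.range G.root).indicator (G.rootShear w)))) :=
  (((carries_permOp_xOp _ _).mul (carries_permOp_zOp _ (contragredient_dotProduct _ _))).comp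
    (carries_hadamardOn_xOp _ _)).comp (carries_permOp_xOp _ _)

theorem carries_unfolding_zOp {s : Q → ZMod 2} (hs : ∀ w, s ⬝ᵥ G.spread w = 0) :
    Carries G.unfolding (zOp s)
      (zOp (contragredient G.edgeEquiv ((Set.range G.root)ᶜ.indicator s))) := by
  have h := ((carries_permOp_xOp G.edgeEquiv _).mul
    (carries_permOp_zOp _ (contragredient_dotProduct G.edgeEquiv _))).comp
      (carries_hadamardOn_zOp (Set.range G.root) ((Set.range G.root)ᶜ.indicator s))
  rw [Set.indicator_indicator, Set.inter_compl_self, Set.indicator_empty', map_zero, xOp_zero,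
    one_mul, Set.indicator_indicator, Set.inter_self] at h
  exact h.comp (carries_permOp_zOp _ (G.indicator_compl_dotProduct_rootShear hs))

theorem incidence_mulVec_of_notMem_vertices (t : E → ZMod 2) {q : Q} (hq : q ∉ G.vertices) :
    (G.incidence *ᵥ t) q = 0 := by
  rw [Matrix.mulVec, G.incidence_of_notMem_vertices q hq, zero_dotProduct]

theorem incidence_mulVec_dotProduct_spread (t : E → ZMod 2) (w : Q → ZMod 2) :
    (G.incidence *ᵥ t) ⬝ᵥ G.spread w = 0 := by
  rw [dotProduct_comm, Matrix.dotProduct_mulVec, spread_vecMul_incidence, zero_dotProduct]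

theorem incidence_mulVec_eq_zero {t : E → ZMod 2}
    (h : ∀ q ∈ G.nonroots, (G.incidence *ᵥ t) q = 0) : G.incidence *ᵥ t = 0 := by
  have hroot : ∀ q ∉ Set.range G.root, (G.incidence *ᵥ t) q = 0 := fun q hq => by
    by_cases hv : q ∈ G.vertices
    · exact h q ⟨hv, hq⟩
    · exact G.incidence_mulVec_of_notMem_vertices t hv
  refine dotProduct_eq_zero _ fun w => ?_
  rw [← G.incidence_mulVec_dotProduct_spread t w]
  refine Finset.sum_congr rfl fun q _ => ?_
  by_cases hq : q ∈ Set.range G.root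
  · obtain ⟨c, rfl⟩ := hq
    rw [spread_root]
  · rw [hroot q hq, zero_mul, zero_mul]

theorem incidence_mulVec_contragredient (u : Q → ZMod 2) {q : Q} (hq : q ∈ G.nonroots) :
    (G.incidence *ᵥ contragredient G.edgeEquiv u) q = u q := by
  classical
  rw [Matrix.mulVec, dotProduct_comm, ← G.edgeEquiv_single hq, contragredient_dotProduct,
    dotProduct_single_one]

theorem exists_carries_unfolding_xOp {w : Q → ZMod 2} (hw : ∀ q ∉ G.vertices, w q = 0) :
    ∃ k, G.incidence *ᵥ k = 0 ∧
      Carries G.unfolding (xOp w) (xOp (w ᵥ* G.incidence) * zOp k) := by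
  have hN : G.edgeEquiv (w + G.spread w) = w ᵥ* G.incidence := by
    rw [edgeEquiv_apply, Matrix.add_vecMul, spread_vecMul_incidence, add_zero]
    intro q hq
    by_cases hv : q ∈ G.vertices
    · obtain ⟨c, rfl⟩ : q ∈ Set.range G.root := by_contra fun h => hq ⟨hv, h⟩
      rw [Pi.add_apply, spread_root, CharTwo.add_self_eq_zero]
    · rw [Pi.add_apply, hw q hv, G.spread_of_notMem hv, add_zero]
  have h := G.carries_unfolding_xOp w
  rw [indicator_compl_range_root_rootShear, indicator_range_root_rootShear, hN] at h
  refine ⟨_, G.incidence_mulVec_eq_zero fun q hq => ?_, h⟩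
  rw [G.incidence_mulVec_contragredient _ hq, Set.indicator_of_notMem hq.2]

theorem exists_carries_unfolding_zOp (t : E → ZMod 2) {b : Q → ZMod 2}
    (hb : ∀ q ∈ G.vertices, b q = 0) :
    ∃ k, G.incidence *ᵥ k = 0 ∧
      Carries G.unfolding (zOp (G.incidence *ᵥ t + b)) (zOp (t + k)) := by
  have hs : ∀ w, (G.incidence *ᵥ t + b) ⬝ᵥ G.spread w = 0 := fun w => by
    rw [add_dotProduct, incidence_mulVec_dotProduct_spread, G.dotProduct_spread hb, add_zero]
  set u := contragredient G.edgeEquiv ((Set.range G.root)ᶜ.indicator (G.incidence *ᵥ t + b))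
    with hu
  refine ⟨t + u, G.incidence_mulVec_eq_zero fun q hq => ?_, ?_⟩
  · rw [Matrix.mulVec_add, Pi.add_apply, hu, G.incidence_mulVec_contragredient _ hq,
      Set.indicator_of_mem (show q ∈ (Set.range G.root)ᶜ from hq.2), Pi.add_apply, hb q hq.1,
      add_zero, CharTwo.add_self_eq_zero]
  · rw [← add_assoc, ZModModule.add_self, zero_add]
    exact G.carries_unfolding_zOp hs

theorem exists_carries_unfolding_eq_zOp {k : E → ZMod 2} (hk : G.incidence *ᵥ k = 0) :
    ∃ w b, (∀ q ∈ G.vertices, b q = 0) ∧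
      Carries G.unfolding (xOp (G.spread w) * zOp b) (zOp k) := by
  set z := contragredient G.edgeEquiv.symm k with hz
  have hznonroots : ∀ q ∈ G.nonroots, z q = 0 := fun q hq => by
    rw [← G.incidence_mulVec_contragredient z hq, hz, contragredient_contragredient_symm, hk,
      Pi.zero_apply]
  have hb : ∀ q ∈ G.vertices, G.verticesᶜ.indicator z q = 0 := fun q hq =>
    Set.indicator_of_notMem (Set.notMem_compl_iff.2 hq) z
  have hsum : (Set.range G.root).indicator (G.spread z) +
      (Set.range G.root)ᶜ.indicator (G.verticesᶜ.indicator z) = z := by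
    funext q
    by_cases hr : q ∈ Set.range G.root
    · rw [Pi.add_apply, Set.indicator_of_mem hr, Set.indicator_of_notMem (not_not.2 hr), add_zero]
      obtain ⟨c, rfl⟩ := hr
      exact G.spread_root z c
    · rw [Pi.add_apply, Set.indicator_of_notMem hr, Set.indicator_of_mem hr, zero_add]
      by_cases hq : q ∈ G.vertices
      · rw [hb q hq, hznonroots q ⟨hq, hr⟩]
      · exact Set.indicator_of_mem hq z
  refine ⟨z, G.verticesᶜ.indicator z, hb, ?_⟩
  have h := (G.carries_unfolding_xOp (G.spread z)).mul
    (G.carries_unfolding_zOp (G.dotProduct_spread hb))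
  rwa [indicator_compl_range_root_rootShear, spread_spread, ZModModule.add_self, map_zero,
    xOp_zero, one_mul, ← zOp_add, ← map_add, indicator_range_root_rootShear, hsum, hz,
    contragredient_contragredient_symm] at h

theorem zOp_mem_map_unfolding {S : Subgroup (Op Q)ˣ} (hX : ∀ w, xOp (G.spread w) ∈ S)
    (hZ : ∀ b, (∀ q ∈ G.vertices, b q = 0) → zOp b ∈ S) {k : E → ZMod 2}
    (hk : G.incidence *ᵥ k = 0) :
    zOp k ∈ S.map (conjHom G.unfolding G.isClifford_unfolding.isUnitary) := by
  obtain ⟨w, b, hb, h⟩ := G.exists_carries_unfolding_eq_zOp hk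
  exact ⟨_, mul_mem (hX w) (hZ b hb), h.conjHom_eq _⟩

theorem map_unfolding_cssGroup {S : Set (Q → ZMod 2)} {T : Set (E → ZMod 2)}
    (hvertices : ∀ a ∈ S, ∀ q ∉ G.vertices, a q = 0)
    (hspread : ∀ w, G.spread w ∈ Submodule.span (ZMod 2) S)
    (hcycle : ∀ k, G.incidence *ᵥ k = 0 → k ∈ Submodule.span (ZMod 2) T) :
    (cssGroup S (G.incidence.mulVec '' T ∪ (fun q => Set.indicator {q} 1) '' G.verticesᶜ)).map
      (conjHom G.unfolding G.isClifford_unfolding.isUnitary) =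
      cssGroup ((· ᵥ* G.incidence) '' S) T := by
  have hU := G.isClifford_unfolding.isUnitary
  set H := cssGroup S (G.incidence.mulVec '' T ∪ (fun q => Set.indicator {q} 1) '' G.verticesᶜ)
    with hH
  have hcycle' : ∀ k, G.incidence *ᵥ k = 0 → zOp k ∈ H.map (conjHom G.unfolding hU) := fun k hk =>
    G.zOp_mem_map_unfolding (fun w => xOp_mem_cssGroup (hspread w)) (fun b hb =>
      zOp_mem_cssGroup (Submodule.span_mono Set.subset_union_right
        (mem_span_indicator_singleton fun q hq => hb q (not_not.1 hq)))) hk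
  apply le_antisymm
  · rw [Subgroup.map_le_iff_le_comap, hH, cssGroup_le]
    refine ⟨fun a ha => ?_, ?_⟩
    · obtain ⟨k, hk, h⟩ := G.exists_carries_unfolding_xOp (hvertices a ha)
      rw [Subgroup.mem_comap, h.conjHom_eq]
      exact mul_mem (xOp_mem_cssGroup (Submodule.subset_span ⟨a, ha, rfl⟩))
        (zOp_mem_cssGroup (hcycle k hk))
    · rintro _ (⟨t, ht, rfl⟩ | ⟨q, hq, rfl⟩)
      · obtain ⟨k, hk, h⟩ := G.exists_carries_unfolding_zOp t (b := 0) fun _ _ => rfl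
        rw [add_zero] at h
        rw [Subgroup.mem_comap, h.conjHom_eq]
        exact zOp_mem_cssGroup (add_mem (Submodule.subset_span ht) (hcycle k hk))
      · obtain ⟨k, hk, h⟩ := G.exists_carries_unfolding_zOp 0 (b := Set.indicator {q} 1)
          fun p hp => Set.indicator_of_notMem (fun h : p = q => hq (h ▸ hp)) 1
        rw [Matrix.mulVec_zero, zero_add, zero_add] at h
        rw [Subgroup.mem_comap, h.conjHom_eq]
        exact zOp_mem_cssGroup (hcycle k hk)
  · refine cssGroup_le.2 ⟨?_, fun t ht => ?_⟩
    · rintro _ ⟨a, ha, rfl⟩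
      obtain ⟨k, hk, h⟩ := G.exists_carries_unfolding_xOp (hvertices a ha)
      rw [← mul_mem_cancel_right (hcycle' k hk), ← h.conjHom_eq hU]
      exact Subgroup.mem_map_of_mem _ (xOp_mem_cssGroup (Submodule.subset_span ha))
    · obtain ⟨k, hk, h⟩ := G.exists_carries_unfolding_zOp t (b := 0) fun _ _ => rfl
      rw [← mul_mem_cancel_right (hcycle' k hk), ← zOp_add, ← h.conjHom_eq hU, add_zero]
      exact Subgroup.mem_map_of_mem _
        (zOp_mem_cssGroup (Submodule.subset_span (Or.inl ⟨t, ht, rfl⟩)))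

end RootedGraph

end Encoding

section Colors

/-- The proper faces of a `(d + 1)`-dimensional orthant, as the sets of axes that span them. -/
abbrev OrthantFace (d : ℕ) : Type := {T : Finset (Fin (d + 1)) // T ≠ Finset.univ}

/-- The face of the orthant spanned by all axes but the `i`-th. -/
def orthantFacet {d : ℕ} (i : Fin (d + 1)) : OrthantFace d :=
  ⟨{i}ᶜ, by rw [Ne, Finset.compl_eq_univ_iff]; exact Finset.singleton_ne_empty i⟩

theorem le_orthantFacet_iff {d : ℕ} {i : Fin (d + 1)} {T : OrthantFace d} :
    T ≤ orthantFacet i ↔ i ∉ T.1 := by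
  rw [← Subtype.coe_le_coe, orthantFacet, Finset.subset_compl_singleton]

theorem card_orthantFacet {d : ℕ} (i : Fin (d + 1)) : (orthantFacet i).1.card = d := by
  rw [orthantFacet, Finset.card_compl, Fintype.card_fin, Finset.card_singleton, Nat.add_sub_cancel]

theorem exists_eq_orthantFacet {d : ℕ} {T : OrthantFace d}
    (hT : T.1.card = d) : ∃ i, T = orthantFacet i := by
  have hcard : T.1ᶜ.card = 1 := by
    rw [Finset.card_compl, Fintype.card_fin, hT, Nat.add_sub_cancel_left]
  obtain ⟨i, hi⟩ := Finset.card_eq_one.1 hcard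
  exact ⟨i, Subtype.ext (compl_eq_comm.1 hi).symm⟩

namespace ColoredLattice

variable {Cell : Type*} [PartialOrder Cell] {d : ℕ} (L : ColoredLattice Cell d) {v x y : Cell}

theorem color_symm_orthantFacet_injective {φ : Set.Ici v ≃o OrthantFace d}
    (hφ : ∀ x, L.dim x.1 = (φ x).1.card) :
    Function.Injective fun i => L.color (φ.symm (orthantFacet i)).1 := by
  have hdim : ∀ i, L.dim (φ.symm (orthantFacet i)).1 = d := fun i => by
    rw [hφ, OrderIso.apply_symm_apply, card_orthantFacet]
  intro i j hij
  by_contra hne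
  have hridge : ({i, j}ᶜ : Finset (Fin (d + 1))) ≠ Finset.univ := by
    rw [Ne, Finset.compl_eq_univ_iff]
    exact Finset.insert_ne_empty i {j}
  refine L.color_ne _ _ (hdim i) (hdim j) (fun h => ?_) ⟨(φ.symm ⟨_, hridge⟩).1, ?_, ?_, ?_⟩ hij
  · have h' : orthantFacet i ≤ orthantFacet j := (φ.symm.injective (Subtype.ext h)).le
    rw [le_orthantFacet_iff, orthantFacet, Finset.notMem_compl, Finset.mem_singleton] at h'
    exact hne h'.symm
  · rw [hφ, OrderIso.apply_symm_apply, Finset.card_compl, Finset.card_pair hne, Fintype.card_fin]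
    have := i.2
    have := j.2
    have := Fin.val_ne_iff.2 hne
    omega
  · exact φ.symm.monotone (le_orthantFacet_iff.2 (by simp))
  · exact φ.symm.monotone (le_orthantFacet_iff.2 (by simp))

theorem color_mem_colorsOf_iff {φ : Set.Ici v ≃o OrthantFace d}
    (hφ : ∀ x, L.dim x.1 = (φ x).1.card) (x : Set.Ici v) (i : Fin (d + 1)) :
    L.color (φ.symm (orthantFacet i)).1 ∈ L.colorsOf x.1 ↔ i ∉ (φ x).1 := by
  constructor
  · rintro ⟨⟨c, hc, hcolor⟩, hxc⟩
    obtain ⟨j, hj⟩ := exists_eq_orthantFacet (T := φ ⟨c, le_trans x.2 hxc⟩) ((hφ _).symm.trans hc)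
    have hcj : φ.symm (orthantFacet j) = ⟨c, le_trans x.2 hxc⟩ := by
      rw [← hj, OrderIso.symm_apply_apply]
    have hji : j = i := by
      refine L.color_symm_orthantFacet_injective hφ ?_
      change L.color (φ.symm (orthantFacet j)).1 = _
      rw [hcj, hcolor]
    rw [← hji, ← le_orthantFacet_iff, ← hj]
    exact φ.monotone hxc
  · intro hi
    have hx : x ≤ φ.symm (orthantFacet i) := by rwa [OrderIso.le_symm_apply, le_orthantFacet_iff]
    exact ⟨⟨_, (hφ _).trans (by rw [OrderIso.apply_symm_apply, card_orthantFacet]), rfl⟩, hx⟩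

theorem exists_chart (hv : L.dim v = 0) :
    ∃ (φ : Set.Ici v ≃o OrthantFace d)
      (ε : Equiv.Perm (Fin (d + 1))), (∀ x, L.dim x.1 = (φ x).1.card) ∧
        ∀ x i, ε i ∈ L.colorsOf x.1 ↔ i ∉ (φ x).1 := by
  obtain ⟨φ, hφ⟩ := L.valence v hv
  exact ⟨φ, Equiv.ofBijective _
    (Finite.injective_iff_bijective.1 (L.color_symm_orthantFacet_injective hφ)), hφ,
    L.color_mem_colorsOf_iff hφ⟩

theorem colorsOf_anti (h : x ≤ y) : L.colorsOf y ⊆ L.colorsOf x :=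
  fun _ ⟨c, hc⟩ => ⟨c, h.trans hc⟩

theorem le_of_colorsOf_subset (hv : L.dim v = 0) (hx : v ≤ x) (hy : v ≤ y)
    (h : L.colorsOf y ⊆ L.colorsOf x) : x ≤ y := by
  obtain ⟨φ, ε, -, hε⟩ := L.exists_chart hv
  refine φ.le_iff_le.1 (show φ ⟨x, hx⟩ ≤ φ ⟨y, hy⟩ from fun i hi => ?_)
  by_contra hi'
  exact (hε ⟨x, hx⟩ i).1 (h ((hε ⟨y, hy⟩ i).2 hi')) hi

theorem eq_of_colorsOf_eq (hv : L.dim v = 0) (hx : v ≤ x) (hy : v ≤ y)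
    (h : L.colorsOf x = L.colorsOf y) : x = y :=
  le_antisymm (L.le_of_colorsOf_subset hv hx hy h.ge) (L.le_of_colorsOf_subset hv hy hx h.le)

theorem exists_colorsOf_eq (hv : L.dim v = 0) {S : Set (Fin (d + 1))} (hS : S.Nonempty) :
    ∃ x, v ≤ x ∧ L.colorsOf x = S := by
  classical
  obtain ⟨φ, ε, -, hε⟩ := L.exists_chart hv
  obtain ⟨s, hs⟩ := hS
  have hT : (Finset.univ.filter fun i => ε i ∉ S) ≠ Finset.univ := fun h => by
    have := Finset.mem_univ (ε.symm s)
    rw [← h, Finset.mem_filter, Equiv.apply_symm_apply] at this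
    exact this.2 hs
  refine ⟨(φ.symm ⟨_, hT⟩).1, (φ.symm ⟨_, hT⟩).2, ?_⟩
  ext i
  obtain ⟨i, rfl⟩ := ε.surjective i
  rw [hε, OrderIso.apply_symm_apply, Finset.mem_filter, not_and, not_not]
  exact ⟨fun h => h (Finset.mem_univ i), fun h _ => h⟩

theorem ncard_compl_colorsOf (x : Cell) : (L.colorsOf x)ᶜ.ncard = L.dim x := by
  obtain ⟨v, hvx, hv⟩ := L.exists_vertex x
  obtain ⟨φ, ε, hφ, hε⟩ := L.exists_chart hv
  have h : (L.colorsOf x)ᶜ = ε '' (φ ⟨x, hvx⟩).1 := by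
    ext i
    obtain ⟨i, rfl⟩ := ε.surjective i
    rw [Set.mem_compl_iff, hε ⟨x, hvx⟩, not_not, ε.injective.mem_set_image, Finset.mem_coe]
  rw [h, Set.ncard_image_of_injective _ ε.injective, Set.ncard_coe_finset, ← hφ]

theorem dim_eq_of_colorsOf_eq_compl {S : Set (Fin (d + 1))} (h : L.colorsOf x = Sᶜ) :
    L.dim x = S.ncard := by
  rw [← L.ncard_compl_colorsOf, h, compl_compl]

theorem colorsOf_cellOfColor {i : Fin (d + 1)} (c : L.CellOfColor i) : L.colorsOf c.1 = {i} := by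
  have h := Set.ncard_add_ncard_compl (L.colorsOf c.1)
  rw [Nat.card_eq_fintype_card, Fintype.card_fin, ncard_compl_colorsOf, c.2.1, add_comm,
    add_right_inj] at h
  obtain ⟨j, hj⟩ := Set.ncard_eq_one.1 h
  have hi : i ∈ L.colorsOf c.1 := ⟨c, le_rfl⟩
  rw [hj] at hi ⊢
  rw [Set.mem_singleton_iff.1 hi]

theorem exists_colorsOf_edge (hx : L.dim x = 1) : ∃ i, L.colorsOf x = {i}ᶜ := by
  obtain ⟨i, hi⟩ := Set.ncard_eq_one.1 ((L.ncard_compl_colorsOf x).trans hx)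
  exact ⟨i, by rw [← hi, compl_compl]⟩

theorem exists_colorsOf_face (hx : L.dim x = 2) : ∃ i j, i ≠ j ∧ L.colorsOf x = {i, j}ᶜ := by
  obtain ⟨i, j, hij, h⟩ := Set.ncard_eq_two.1 ((L.ncard_compl_colorsOf x).trans hx)
  exact ⟨i, j, hij, by rw [← h, compl_compl]⟩

theorem mem_colorsOf_vertex (v : L.CellOfDim 0) (i : Fin (d + 1)) : i ∈ L.colorsOf v.1 := by
  have h := L.ncard_compl_colorsOf v.1
  rw [v.2, Set.ncard_eq_zero, Set.compl_empty_iff] at h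
  exact h ▸ Set.mem_univ i

theorem existsUnique_cellOfColor {i : Fin (d + 1)} (hi : i ∈ L.colorsOf x) :
    ∃! c : L.CellOfColor i, x ≤ c.1 := by
  obtain ⟨c, hc⟩ := hi
  refine ⟨c, hc, fun c' hc' => Subtype.ext ?_⟩
  obtain ⟨v, hvx, hv⟩ := L.exists_vertex x
  exact L.eq_of_colorsOf_eq hv (hvx.trans hc') (hvx.trans hc)
    ((L.colorsOf_cellOfColor c').trans (L.colorsOf_cellOfColor c).symm)

theorem le_cellOfColor_of_vertex_le {i : Fin (d + 1)} {c : L.CellOfColor i} (hv : L.dim v = 0)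
    (hvx : v ≤ x) (hvc : v ≤ c.1) (hi : i ∈ L.colorsOf x) : x ≤ c.1 :=
  L.le_of_colorsOf_subset hv hvx hvc
    (L.colorsOf_cellOfColor c ▸ Set.singleton_subset_iff.2 hi)

end ColoredLattice

end Colors

section Incidence

theorem indicator_one_dotProduct_indicator_one {ι R : Type*} [Fintype ι] [NonAssocSemiring R]
    (s t : Set ι) : s.indicator (1 : ι → R) ⬝ᵥ t.indicator 1 = ((s ∩ t).ncard : R) := by
  classical
  rw [indicator_dotProduct, Set.indicator_indicator, one_dotProduct, Set.ncard_eq_toFinset_card',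
    Set.toFinset_card, Fintype.card_subtype, ← Finset.sum_boole]
  simp only [Set.indicator_apply, Pi.one_apply]

namespace ColoredLattice

variable {Cell : Type*} [PartialOrder Cell] {d : ℕ} (L : ColoredLattice Cell d)

/-- The edge of the lattice that carries a toric code qubit. -/
def edgeCell (e : L.TargetQubit) : Cell := e.2.1.1

theorem dim_edgeCell (e : L.TargetQubit) : L.dim (L.edgeCell e) = 1 := e.2.1.2

theorem colorsOf_edgeCell (e : L.TargetQubit) : L.colorsOf (L.edgeCell e) = {e.1.succ}ᶜ := e.2.2

theorem edgeCell_injective : Function.Injective L.edgeCell := by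
  rintro ⟨j, ⟨e, he⟩, h⟩ ⟨j', ⟨e', he'⟩, h'⟩ (heq : e = e')
  subst heq
  obtain rfl : j = j' :=
    Fin.succ_injective d (Set.singleton_injective (compl_injective (h.symm.trans h')))
  rfl

theorem zero_mem_colorsOf_edgeCell (e : L.TargetQubit) : 0 ∈ L.colorsOf (L.edgeCell e) := by
  rw [colorsOf_edgeCell]
  exact (Fin.succ_ne_zero e.1).symm

theorem exists_edgeCell_eq {x : Cell} (hx : L.dim x = 1) (h0 : 0 ∈ L.colorsOf x) :
    ∃ e, L.edgeCell e = x := by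
  obtain ⟨i, hi⟩ := L.exists_colorsOf_edge hx
  obtain ⟨j, rfl⟩ := Fin.exists_succ_eq.2 (show i ≠ 0 from fun h => by simp [hi, h] at h0)
  exact ⟨⟨j, ⟨x, hx⟩, hi⟩, rfl⟩

theorem existsUnique_edge (v : L.CellOfDim 0) (j : Fin d) :
    ∃! e : L.TargetQubit, e.1 = j ∧ v.1 ≤ L.edgeCell e := by
  obtain ⟨x, hvx, hx⟩ := L.exists_colorsOf_eq v.2 (S := {j.succ}ᶜ) ⟨0, (Fin.succ_ne_zero j).symm⟩
  have hdim : L.dim x = 1 := by rw [L.dim_eq_of_colorsOf_eq_compl hx, Set.ncard_singleton]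
  refine ⟨⟨j, ⟨x, hdim⟩, hx⟩, ⟨rfl, hvx⟩, ?_⟩
  rintro e ⟨rfl, he⟩
  exact L.edgeCell_injective
    (L.eq_of_colorsOf_eq v.2 he hvx ((L.colorsOf_edgeCell e).trans hx.symm))

theorem ncard_verticesOf_edge {x : Cell} (hx : L.dim x = 1) : (L.verticesOf x).ncard = 2 := by
  rw [← L.edge_ends x hx, ← Set.ncard_image_of_injective _ Subtype.val_injective]
  congr 1
  ext v
  simp [verticesOf, and_comm]

theorem inl_mem_sourceRegion_iff {c : L.CellOfColor 0} {v : L.CellOfDim 0} :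
    Sum.inl v ∈ L.sourceRegion c ↔ v.1 ≤ c.1 := by
  simp [sourceRegion, verticesOf]

theorem inr_mem_sourceRegion_iff {c : L.CellOfColor 0} {a : L.Ancilla} :
    Sum.inr a ∈ L.sourceRegion c ↔ a.1 = c := by
  simp [sourceRegion]

theorem existsUnique_mem_sourceRegion (q : L.SourceQubit) : ∃! c, q ∈ L.sourceRegion c := by
  cases q with
  | inl v =>
    simpa only [inl_mem_sourceRegion_iff] using
      L.existsUnique_cellOfColor (L.mem_colorsOf_vertex v 0)
  | inr a => simpa only [inr_mem_sourceRegion_iff] using existsUnique_eq'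

theorem existsUnique_mem_targetRegion (e : L.TargetQubit) : ∃! c, e ∈ L.targetRegion c :=
  L.existsUnique_cellOfColor (L.zero_mem_colorsOf_edgeCell e)

theorem edgeCell_le_iff {v : L.CellOfDim 0} {e : L.TargetQubit} (h : v.1 ≤ L.edgeCell e)
    (c : L.CellOfColor 0) : L.edgeCell e ≤ c.1 ↔ v.1 ≤ c.1 :=
  ⟨h.trans, fun hc => L.le_cellOfColor_of_vertex_le v.2 h hc (L.zero_mem_colorsOf_edgeCell e)⟩

theorem ncard_verticesOf_le_ncard_targetRegion [Finite Cell] (hd : 2 ≤ d) (c : L.CellOfColor 0) :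
    (L.verticesOf c.1).ncard ≤ (L.targetRegion c).ncard := by
  classical
  have := Fintype.ofFinite Cell
  rw [Set.ncard_eq_toFinset_card', Set.ncard_eq_toFinset_card']
  refine Nat.le_of_mul_le_mul_right (Finset.card_mul_le_card_mul
    (fun v e => v.1 ≤ L.edgeCell e) (fun v hv => ?_) fun e _ => ?_) two_pos
  · obtain ⟨e, ⟨he, hve⟩, -⟩ := L.existsUnique_edge v ⟨0, by omega⟩
    obtain ⟨e', ⟨he', hve'⟩, -⟩ := L.existsUnique_edge v ⟨1, by omega⟩
    have hne : e ≠ e' := by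
      rintro rfl
      simp [he] at he'
    rw [← Finset.card_pair hne]
    refine Finset.card_le_card fun p hp => ?_
    have hvp : v.1 ≤ L.edgeCell p := by
      rcases Finset.mem_insert.1 hp with rfl | hp
      · exact hve
      · rwa [Finset.mem_singleton.1 hp]
    rw [Set.mem_toFinset] at hv
    rw [Finset.mem_bipartiteAbove, Set.mem_toFinset]
    exact ⟨(L.edgeCell_le_iff hvp c).2 hv, hvp⟩
  · rw [← L.ncard_verticesOf_edge (L.dim_edgeCell e), Set.ncard_eq_toFinset_card']
    refine Finset.card_le_card fun v hv => ?_
    exact Set.mem_toFinset.2 ((Finset.mem_bipartiteBelow _).1 hv).2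

theorem ncard_edgesOf (c : L.CellOfColor 0) :
    (L.edgesOf c.1).ncard = (L.targetRegion c).ncard := by
  have himage : (fun e : L.TargetQubit => e.2.1) '' L.targetRegion c = L.edgesOf c.1 := by
    ext x
    constructor
    · rintro ⟨e, he, rfl⟩
      exact he
    · intro hx
      obtain ⟨e, he⟩ := L.exists_edgeCell_eq x.2 ⟨c, hx⟩
      exact ⟨e, (show L.edgeCell e ≤ c.1 from he ▸ hx), Subtype.ext he⟩
  rw [← himage, Set.ncard_image_of_injective]
  exact fun e e' h => L.edgeCell_injective (congrArg Subtype.val h)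

theorem ncard_sourceRegion [Finite Cell] (hd : 2 ≤ d) (c : L.CellOfColor 0) :
    (L.sourceRegion c).ncard = (L.targetRegion c).ncard := by
  have hancilla : {a : L.Ancilla | a.1 = c}.ncard =
      (L.targetRegion c).ncard - (L.verticesOf c.1).ncard := by
    rw [← ncard_edgesOf, ← Nat.card_coe_set_eq, Set.coe_ofPred,
      Nat.card_congr (Equiv.sigmaSubtype c), Nat.card_eq_fintype_card, Fintype.card_fin]
  rw [sourceRegion, Set.ncard_union_eq (Set.disjoint_image_inl_image_inr),
    Set.ncard_image_of_injective _ Sum.inl_injective,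
    Set.ncard_image_of_injective _ Sum.inr_injective, hancilla,
    Nat.add_sub_cancel' (L.ncard_verticesOf_le_ncard_targetRegion hd c)]

/-- The vertices of a cell, as a binary vector on the qubits of the color code and the ancillas. -/
def vertexVec (x : Cell) : L.SourceQubit → ZMod 2 := (Sum.inl '' L.verticesOf x).indicator 1

/-- The incidence matrix of vertices and edges, with a zero row for each ancilla. -/
def incidence : Matrix L.SourceQubit L.TargetQubit (ZMod 2) :=
  Matrix.of fun q e => L.vertexVec (L.edgeCell e) q

theorem vertexVec_inl_of_le {v : L.CellOfDim 0} {x : Cell} (h : v.1 ≤ x) :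
    L.vertexVec x (Sum.inl v) = 1 := by
  have hv : v ∈ L.verticesOf x := h
  exact Set.indicator_of_mem (Set.mem_image_of_mem Sum.inl hv) 1

theorem vertexVec_inl_of_not_le {v : L.CellOfDim 0} {x : Cell} (h : ¬v.1 ≤ x) :
    L.vertexVec x (Sum.inl v) = 0 := by
  have hv : v ∉ L.verticesOf x := h
  exact Set.indicator_of_notMem (by rwa [Sum.inl_injective.mem_set_image]) 1

theorem vertexVec_inr (x : Cell) (a : L.Ancilla) : L.vertexVec x (Sum.inr a) = 0 :=
  Set.indicator_of_notMem (by rintro ⟨_, _, h⟩; exact Sum.inl_ne_inr h) 1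

theorem incidence_apply (q : L.SourceQubit) (e : L.TargetQubit) :
    L.incidence q e = L.vertexVec (L.edgeCell e) q :=
  rfl

theorem incidence_inr (a : L.Ancilla) : L.incidence (Sum.inr a) = 0 :=
  funext fun _ => L.vertexVec_inr _ a

theorem incidence_ne_zero {q : L.SourceQubit} {e : L.TargetQubit} (h : L.incidence q e ≠ 0) :
    ∃ v, v.1 ≤ L.edgeCell e ∧ Sum.inl v = q := by
  have hq : q ∈ Sum.inl '' L.verticesOf (L.edgeCell e) := Set.mem_of_indicator_ne_zero h
  obtain ⟨v, hv, rfl⟩ := hq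
  exact ⟨v, hv, rfl⟩

theorem mem_sourceRegion_iff_of_incidence_ne_zero {q : L.SourceQubit} {e : L.TargetQubit}
    {c : L.CellOfColor 0} (h : L.incidence q e ≠ 0) :
    q ∈ L.sourceRegion c ↔ e ∈ L.targetRegion c := by
  obtain ⟨v, hv, rfl⟩ := L.incidence_ne_zero h
  rw [inl_mem_sourceRegion_iff]
  exact (L.edgeCell_le_iff hv c).symm

section Fintype

variable [Fintype L.SourceQubit]

theorem vertexVec_dotProduct_vertexVec (x y : Cell) :
    L.vertexVec x ⬝ᵥ L.vertexVec y = ((L.verticesOf y ∩ L.verticesOf x).ncard : ZMod 2) := by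
  rw [vertexVec, vertexVec, indicator_one_dotProduct_indicator_one, Set.inter_comm,
    ← Set.image_inter Sum.inl_injective, Set.ncard_image_of_injective _ Sum.inl_injective]

theorem vertexVec_vecMul_incidence (x : Cell) (e : L.TargetQubit) :
    (L.vertexVec x ᵥ* L.incidence) e =
      ((L.verticesOf (L.edgeCell e) ∩ L.verticesOf x).ncard : ZMod 2) :=
  L.vertexVec_dotProduct_vertexVec x (L.edgeCell e)

theorem one_vecMul_incidence : 1 ᵥ* L.incidence = 0 := by
  funext e
  have h := indicator_one_dotProduct_indicator_one (R := ZMod 2) Set.univ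
    ((Sum.inl : _ → L.SourceQubit) '' L.verticesOf (L.edgeCell e))
  rw [Set.indicator_univ, Set.univ_inter, Set.ncard_image_of_injective _ Sum.inl_injective,
    L.ncard_verticesOf_edge (L.dim_edgeCell e)] at h
  exact h

theorem vertexVec_vecMul_incidence_of_ne {i : Fin (d + 1)} (c : L.CellOfColor i)
    {e : L.TargetQubit} (he : e.1.succ ≠ i) : (L.vertexVec c.1 ᵥ* L.incidence) e = 0 := by
  rw [vertexVec_vecMul_incidence]
  rcases Set.eq_empty_or_nonempty (L.verticesOf (L.edgeCell e) ∩ L.verticesOf c.1) with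
    h | ⟨v, hve, hvc⟩
  · rw [h, Set.ncard_empty, Nat.cast_zero]
  · have hi : i ∈ L.colorsOf (L.edgeCell e) := by
      rw [colorsOf_edgeCell]
      exact fun h => he (Set.mem_singleton_iff.1 h).symm
    have hle := L.le_cellOfColor_of_vertex_le v.2 hve hvc hi
    have hsub : L.verticesOf (L.edgeCell e) ⊆ L.verticesOf c.1 := fun _ hu => le_trans hu hle
    rw [Set.inter_eq_left.2 hsub, L.ncard_verticesOf_edge (L.dim_edgeCell e)]
    rfl

end Fintype

end ColoredLattice

end Incidence

section Homology

theorem eq_sum_indicator {I ι M : Type*} [Fintype I] [AddCommMonoid M] {B : I → Set ι}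
    (hB : ∀ i, ∃! c, i ∈ B c) (k : ι → M) : k = ∑ c, (B c).indicator k := by
  funext i
  obtain ⟨c, hc, hunique⟩ := hB i
  rw [Finset.sum_apply, Fintype.sum_eq_single c fun c' hc' =>
    Set.indicator_of_notMem (fun h => hc' (hunique c' h)) k, Set.indicator_of_mem hc]

theorem mulVec_indicator {ι κ R : Type*} [Fintype κ] [NonUnitalNonAssocSemiring R]
    {D : Matrix ι κ R} {A : Set ι} {B : Set κ} (h : ∀ i j, D i j ≠ 0 → (i ∈ A ↔ j ∈ B))
    (k : κ → R) : D *ᵥ B.indicator k = A.indicator (D *ᵥ k) := by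
  funext i
  by_cases hi : i ∈ A
  · rw [Set.indicator_of_mem hi, Matrix.mulVec_apply_eq_sum, Matrix.mulVec_apply_eq_sum]
    refine Finset.sum_congr rfl fun j _ => ?_
    by_cases hj : j ∈ B
    · rw [Set.indicator_of_mem hj]
    · rw [not_not.1 fun hD => hj ((h i j hD).1 hi), zero_mul, zero_mul]
  · rw [Set.indicator_of_notMem hi, Matrix.mulVec_apply_eq_sum]
    refine Finset.sum_eq_zero fun j _ => ?_
    by_cases hj : j ∈ B
    · rw [not_not.1 fun hD => hi ((h i j hD).2 hj), zero_mul]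
    · rw [Set.indicator_of_notMem hj, mul_zero]

section CellBoundary

variable {Cell : Type*} [PartialOrder Cell] {dim : Cell → ℕ} {w : Cell → ZMod 2} {y : Cell}

theorem cellBoundary_eq_finsum_indicator (hw : ∀ x, w x ≠ 0 → dim x = dim y + 1) :
    cellBoundary dim w y = ∑ᶠ x, (Set.Ici y).indicator w x := by
  classical
  have h : ∀ x, (Set.Ici y).indicator w x = {x | y ≤ x ∧ dim x = dim y + 1}.indicator w x := by
    intro x
    by_cases hx : w x = 0
    · rw [Set.indicator_apply_eq_zero.2 fun _ => hx, Set.indicator_apply_eq_zero.2 fun _ => hx]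
    · simp [Set.indicator_apply, hw x hx]
  exact (finsum_mem_def {x | y ≤ x ∧ dim x = dim y + 1} w).trans
    (finsum_congr fun x => (h x).symm)

theorem cellBoundary_eq_zero (hw : ∀ x, w x ≠ 0 → dim x ≠ dim y + 1) :
    cellBoundary dim w y = 0 := by
  refine finsum_mem_eq_zero_of_forall_eq_zero fun x (hx : y ≤ x ∧ dim x = dim y + 1) => ?_
  by_contra h
  exact hw x h hx.2

end CellBoundary

namespace ColoredLattice

variable {Cell : Type*} [PartialOrder Cell] {d : ℕ} (L : ColoredLattice Cell d)

/-- A vector on the qubits of the toric codes, as a cellular chain. -/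
def edgeChain (t : L.TargetQubit → ZMod 2) : Cell → ZMod 2 := Function.extend L.edgeCell t 0

theorem edgeChain_edgeCell (t : L.TargetQubit → ZMod 2) (e : L.TargetQubit) :
    L.edgeChain t (L.edgeCell e) = t e :=
  L.edgeCell_injective.extend_apply t 0 e

theorem edgeChain_of_notMem {t : L.TargetQubit → ZMod 2} {x : Cell}
    (hx : x ∉ Set.range L.edgeCell) : L.edgeChain t x = 0 :=
  Function.extend_apply' _ _ _ hx

theorem exists_of_edgeChain_ne_zero {t : L.TargetQubit → ZMod 2} {x : Cell}
    (h : L.edgeChain t x ≠ 0) : ∃ e, L.edgeCell e = x ∧ t e ≠ 0 := by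
  obtain ⟨e, rfl⟩ := not_not.1 fun hx => h (L.edgeChain_of_notMem hx)
  exact ⟨e, rfl, by rwa [edgeChain_edgeCell] at h⟩

theorem edgeChain_comp_edgeCell {w : Cell → ZMod 2} {c : L.CellOfColor 0}
    (hw : IsChainIn L.dim c.1 1 w) : L.edgeChain (w ∘ L.edgeCell) = w := by
  funext x
  by_cases hx : x ∈ Set.range L.edgeCell
  · obtain ⟨e, rfl⟩ := hx
    exact L.edgeChain_edgeCell _ e
  · rw [L.edgeChain_of_notMem hx]
    by_contra h
    obtain ⟨hxc, hdim⟩ := hw x (Ne.symm h)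
    exact hx (L.exists_edgeCell_eq hdim ⟨c, hxc⟩)

section Fintype

variable [Finite Cell] [Fintype L.TargetQubit]

theorem cellBoundary_edgeChain_vertex (t : L.TargetQubit → ZMod 2) (v : L.CellOfDim 0) :
    cellBoundary L.dim (L.edgeChain t) v.1 = (L.incidence *ᵥ t) (Sum.inl v) := by
  have := Fintype.ofFinite Cell
  simp only [Matrix.mulVec_apply_eq_sum, incidence_apply]
  rw [cellBoundary_eq_finsum_indicator, finsum_eq_sum_of_fintype]
  · refine (Fintype.sum_of_injective L.edgeCell L.edgeCell_injective _ _ (fun x hx => ?_)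
      fun e => ?_).symm
    · rw [Set.indicator_apply_eq_zero]
      exact fun _ => L.edgeChain_of_notMem hx
    · by_cases hve : v.1 ≤ L.edgeCell e
      · rw [Set.indicator_of_mem (Set.mem_Ici.2 hve), edgeChain_edgeCell,
          L.vertexVec_inl_of_le hve, one_mul]
      · rw [Set.indicator_of_notMem fun h => hve (Set.mem_Ici.1 h),
          L.vertexVec_inl_of_not_le hve, zero_mul]
  · intro x hx
    obtain ⟨e, rfl, -⟩ := L.exists_of_edgeChain_ne_zero hx
    rw [v.2, dim_edgeCell]

theorem cellBoundary_edgeChain_eq_zero {t : L.TargetQubit → ZMod 2} (ht : L.incidence *ᵥ t = 0) :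
    cellBoundary L.dim (L.edgeChain t) = 0 := by
  funext y
  by_cases hy : L.dim y = 0
  · rw [L.cellBoundary_edgeChain_vertex t ⟨y, hy⟩, ht, Pi.zero_apply, Pi.zero_apply]
  · refine cellBoundary_eq_zero fun x hx => ?_
    obtain ⟨e, rfl, -⟩ := L.exists_of_edgeChain_ne_zero hx
    rw [dim_edgeCell]
    omega

theorem exists_incidence_mulVec_eq [DecidableEq L.SourceQubit] (c : L.CellOfColor 0)
    {u v : L.CellOfDim 0} (hu : u.1 ≤ c.1) (hv : v.1 ≤ c.1) :
    ∃ t, L.incidence *ᵥ t = Pi.single (Sum.inl u) 1 + Pi.single (Sum.inl v) 1 := by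
  classical
  have := Fintype.ofFinite Cell
  obtain ⟨w, hw, hwz⟩ := (L.ball c.1).1 (Pi.single u.1 1 + Pi.single v.1 1)
    (fun x hx => by
      rcases eq_or_ne x u.1 with rfl | hxu
      · exact ⟨hu, u.2⟩
      rcases eq_or_ne x v.1 with rfl | hxv
      · exact ⟨hv, v.2⟩
      · simp [hxu, hxv] at hx)
    (by
      simp only [finsum_eq_sum_of_fintype, Pi.add_apply, Finset.sum_add_distrib,
        Finset.sum_pi_single', Finset.mem_univ, if_true]
      rfl)
  refine ⟨w ∘ L.edgeCell, funext ?_⟩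
  rintro (q | a)
  · rw [← cellBoundary_edgeChain_vertex, L.edgeChain_comp_edgeCell hw, hwz]
    simp [Pi.single_apply, Subtype.ext_iff]
  · rw [Matrix.mulVec, incidence_inr, zero_dotProduct]
    simp

end Fintype

theorem eq_of_vecMul_incidence_eq_zero [Finite Cell] [Fintype L.SourceQubit]
    {w : L.SourceQubit → ZMod 2} (hw : w ᵥ* L.incidence = 0)
    {c : L.CellOfColor 0} {u v : L.CellOfDim 0}
    (hu : u.1 ≤ c.1) (hv : v.1 ≤ c.1) : w (Sum.inl u) = w (Sum.inl v) := by
  classical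
  have := Fintype.ofFinite L.TargetQubit
  obtain ⟨t, ht⟩ := L.exists_incidence_mulVec_eq c hu hv
  rw [← CharTwo.add_eq_zero]
  calc w (Sum.inl u) + w (Sum.inl v) = w ⬝ᵥ L.incidence *ᵥ t := by
        rw [ht, dotProduct_add, dotProduct_single_one, dotProduct_single_one]
    _ = 0 := by rw [Matrix.dotProduct_mulVec, hw, zero_dotProduct]

/-- The edges of a cell that carry toric code qubits, as a binary vector. -/
def edgeVec (x : Cell) : L.TargetQubit → ZMod 2 := {e | L.edgeCell e ≤ x}.indicator 1

/-- The boundary of a face of one of the shrunk lattices, as a binary vector. -/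
def faceVec (p : Σ j : Fin d, L.ShrunkFace j.succ) : L.TargetQubit → ZMod 2 :=
  {e | e.1 = p.1 ∧ L.edgeCell e ≤ p.2.1.1}.indicator 1

theorem faceVec_apply_of_mem {j : Fin d} {f : L.ShrunkFace j.succ} {e : L.TargetQubit}
    (hj : e.1 = j) (hf : L.edgeCell e ≤ f.1.1) : L.faceVec ⟨j, f⟩ e = 1 := by
  have h : e ∈ {e : L.TargetQubit | e.1 = j ∧ L.edgeCell e ≤ f.1.1} := ⟨hj, hf⟩
  exact Set.indicator_of_mem h 1

theorem faceVec_ne_zero {j : Fin d} {f : L.ShrunkFace j.succ} {e : L.TargetQubit}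
    (h : L.faceVec ⟨j, f⟩ e ≠ 0) : e.1 = j ∧ L.edgeCell e ≤ f.1.1 := by
  have he : e ∈ {e : L.TargetQubit | e.1 = j ∧ L.edgeCell e ≤ f.1.1} :=
    Set.mem_of_indicator_ne_zero h
  exact he

theorem edgeVec_mem_span {f : Cell} (hf : L.dim f = 2) (h0 : 0 ∈ L.colorsOf f) :
    L.edgeVec f ∈ Submodule.span (ZMod 2) (Set.range L.faceVec) := by
  obtain ⟨i, j, hij, hcol⟩ := L.exists_colorsOf_face hf
  rw [hcol, Set.mem_compl_iff, Set.mem_insert_iff, Set.mem_singleton_iff, not_or] at h0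
  obtain ⟨i, rfl⟩ := Fin.exists_succ_eq.2 (Ne.symm h0.1)
  obtain ⟨j, rfl⟩ := Fin.exists_succ_eq.2 (Ne.symm h0.2)
  have hsplit : L.edgeVec f = L.faceVec ⟨i, ⟨f, hf⟩, j.succ, hij.symm, hcol⟩ +
      L.faceVec ⟨j, ⟨f, hf⟩, i.succ, hij, hcol.trans (congrArg _ (Set.pair_comm _ _))⟩ := by
    have hne : i ≠ j := fun h => hij (congrArg _ h)
    funext e
    by_cases he : L.edgeCell e ≤ f
    · have hmem := L.colorsOf_anti he
      rw [hcol, L.colorsOf_edgeCell, Set.compl_subset_compl, Set.singleton_subset_iff,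
        Set.mem_insert_iff, Set.mem_singleton_iff, Fin.succ_inj, Fin.succ_inj] at hmem
      rcases hmem with h | h
      · simp [edgeVec, faceVec, he, h, hne]
      · simp [edgeVec, faceVec, he, h, hne.symm]
    · simp [edgeVec, faceVec, he]
  rw [hsplit]
  exact add_mem (Submodule.subset_span ⟨_, rfl⟩) (Submodule.subset_span ⟨_, rfl⟩)

section Fintype

variable [Fintype L.TargetQubit]

theorem incidence_mulVec_faceVec (p : Σ j : Fin d, L.ShrunkFace j.succ) :
    L.incidence *ᵥ L.faceVec p = L.vertexVec p.2.1.1 := by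
  obtain ⟨j, f, i, hi, hf⟩ := p
  funext q
  cases q with
  | inr a => rw [vertexVec_inr, Matrix.mulVec, incidence_inr, zero_dotProduct]
  | inl v =>
    simp only [Matrix.mulVec_apply_eq_sum, incidence_apply]
    by_cases hv : v.1 ≤ f.1
    · obtain ⟨e, ⟨he, hve⟩, hunique⟩ := L.existsUnique_edge v j
      have hef : L.edgeCell e ≤ f.1 := L.le_of_colorsOf_subset v.2 hve hv (by
        rw [hf, L.colorsOf_edgeCell, he]
        exact Set.compl_subset_compl.2 (by simp))
      rw [L.vertexVec_inl_of_le hv, Fintype.sum_eq_single e, L.vertexVec_inl_of_le hve,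
        L.faceVec_apply_of_mem he hef, one_mul]
      intro e' hne
      by_cases hve' : v.1 ≤ L.edgeCell e'
      · rw [not_not.1 fun h => hne (hunique e' ⟨(L.faceVec_ne_zero h).1, hve'⟩), mul_zero]
      · rw [L.vertexVec_inl_of_not_le hve', zero_mul]
    · rw [L.vertexVec_inl_of_not_le hv]
      refine Finset.sum_eq_zero fun e _ => ?_
      by_cases hve : v.1 ≤ L.edgeCell e
      · rw [not_not.1 fun h => hv (hve.trans (L.faceVec_ne_zero h).2), mul_zero]
      · rw [L.vertexVec_inl_of_not_le hve, zero_mul]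

variable [Finite Cell]

theorem indicator_targetRegion_mem_span {k : L.TargetQubit → ZMod 2}
    (hk : L.incidence *ᵥ k = 0) (c : L.CellOfColor 0) :
    (L.targetRegion c).indicator k ∈ Submodule.span (ZMod 2) (Set.range L.faceVec) := by
  classical
  have := Fintype.ofFinite Cell
  obtain ⟨w, hw, hwz⟩ := (L.ball c.1).2 0 (L.edgeChain ((L.targetRegion c).indicator k))
    (fun x hx => by
      obtain ⟨e, rfl, he⟩ := L.exists_of_edgeChain_ne_zero hx
      have hec : e ∈ L.targetRegion c := Set.mem_of_indicator_ne_zero he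
      exact ⟨hec, L.dim_edgeCell e⟩)
    (L.cellBoundary_edgeChain_eq_zero (by
      rw [mulVec_indicator (A := L.sourceRegion c)
        (fun _ _ => L.mem_sourceRegion_iff_of_incidence_ne_zero), hk, Set.indicator_zero']))
  have hsum : (L.targetRegion c).indicator k = ∑ f, w f • L.edgeVec f := by
    funext e
    rw [← L.edgeChain_edgeCell ((L.targetRegion c).indicator k), ← hwz,
      cellBoundary_eq_finsum_indicator, finsum_eq_sum_of_fintype, Finset.sum_apply]
    · refine Finset.sum_congr rfl fun f _ => ?_
      simp [edgeVec, Set.indicator_apply]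
    · intro f hf
      rw [(hw f hf).2, dim_edgeCell]
  rw [hsum]
  refine sum_mem fun f _ => ?_
  by_cases hf : w f = 0
  · rw [hf, zero_smul]
    exact zero_mem _
  · exact Submodule.smul_mem _ _ (L.edgeVec_mem_span (hw f hf).2 ⟨c, (hw f hf).1⟩)

theorem mem_span_faceVec {k : L.TargetQubit → ZMod 2} (hk : L.incidence *ᵥ k = 0) :
    k ∈ Submodule.span (ZMod 2) (Set.range L.faceVec) := by
  have := Fintype.ofFinite (L.CellOfColor 0)
  rw [eq_sum_indicator L.existsUnique_mem_targetRegion k]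
  exact sum_mem fun c _ => L.indicator_targetRegion_mem_span hk c

end Fintype

end ColoredLattice

end Homology

section StabilizerGroups

theorem RootedGraph.spread_mem_span {I Q E : Type*} [Finite I] [Fintype Q] (G : RootedGraph I Q E)
    (w : Q → ZMod 2) : G.spread w ∈ Submodule.span (ZMod 2)
      (Set.range fun c => (G.vertices ∩ G.source c).indicator (1 : Q → ZMod 2)) := by
  have := Fintype.ofFinite I
  rw [eq_sum_indicator G.existsUnique_source (G.spread w)]
  refine sum_mem fun c _ => ?_
  have h : (G.source c).indicator (G.spread w) =
      w (G.root c) • (G.vertices ∩ G.source c).indicator (1 : Q → ZMod 2) := by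
    funext q
    by_cases hc : q ∈ G.source c
    · by_cases hq : q ∈ G.vertices
      · rw [Set.indicator_of_mem hc, G.spread_of_mem hq hc, Pi.smul_apply,
          Set.indicator_of_mem (Set.mem_inter hq hc), Pi.one_apply, smul_eq_mul, mul_one]
      · rw [Set.indicator_of_mem hc, G.spread_of_notMem hq, Pi.smul_apply,
          Set.indicator_of_notMem fun h => hq h.1, smul_zero]
    · rw [Set.indicator_of_notMem hc, Pi.smul_apply, Set.indicator_of_notMem fun h => hc h.2,
        smul_zero]
  rw [h]
  exact Submodule.smul_mem _ _ (Submodule.subset_span ⟨c, rfl⟩)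

theorem cssGroup_congr_left {Q : Type*} [Finite Q] {S S' T : Set (Q → ZMod 2)}
    (h : Submodule.span (ZMod 2) S = Submodule.span (ZMod 2) S') :
    cssGroup S T = cssGroup S' T := by
  refine le_antisymm (cssGroup_le.2 ⟨fun a ha => ?_, fun b hb => ?_⟩)
    (cssGroup_le.2 ⟨fun a ha => ?_, fun b hb => ?_⟩)
  · exact xOp_mem_cssGroup (h ▸ Submodule.subset_span ha)
  · exact zOp_mem_cssGroup (Submodule.subset_span hb)
  · exact xOp_mem_cssGroup (h.symm ▸ Submodule.subset_span ha)
  · exact zOp_mem_cssGroup (Submodule.subset_span hb)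

theorem TwoComplex.toricCode_eq_cssGroup {V E F : Type*} [Finite E] (K : TwoComplex V E F) :
    K.toricCode = cssGroup (Set.range fun v e => (K.ends v e : ZMod 2))
      (Set.range fun f e => (K.sides f e : ZMod 2)) := by
  simp only [toricCode, cssGroup, pauliX_eq_xOp, pauliZ_eq_zOp, ← Set.range_comp]
  rfl

namespace ColoredLattice

variable {Cell : Type*} [PartialOrder Cell] {d : ℕ} (L : ColoredLattice Cell d)

theorem sumElim_indicator_verticesOf (x : Cell) :
    Sum.elim ((L.verticesOf x).indicator 1) 0 = L.vertexVec x := by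
  funext q
  cases q with
  | inl v =>
    by_cases hv : v ∈ L.verticesOf x
    · exact (Set.indicator_of_mem hv 1).trans (L.vertexVec_inl_of_le hv).symm
    · exact (Set.indicator_of_notMem hv 1).trans (L.vertexVec_inl_of_not_le hv).symm
  | inr a => exact (L.vertexVec_inr x a).symm

theorem range_vertexVec_face [Fintype L.TargetQubit] :
    (Set.range fun f : L.CellOfDim 2 => L.vertexVec f.1) =
      L.incidence.mulVec '' Set.range L.faceVec := by
  rw [← Set.range_comp]
  refine subset_antisymm ?_ ?_
  · rintro _ ⟨f, rfl⟩
    obtain ⟨i, j, hij, hf⟩ := L.exists_colorsOf_face f.2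
    by_cases hi : i = 0
    · obtain ⟨j, rfl⟩ := Fin.exists_succ_eq.2 (hi ▸ hij.symm)
      exact ⟨⟨j, f, i, hij, hf.trans (congrArg _ (Set.pair_comm _ _))⟩,
        L.incidence_mulVec_faceVec _⟩
    · obtain ⟨i, rfl⟩ := Fin.exists_succ_eq.2 hi
      exact ⟨⟨i, f, j, hij.symm, hf⟩, L.incidence_mulVec_faceVec _⟩
  · rintro _ ⟨p, rfl⟩
    exact ⟨p.2.1, (L.incidence_mulVec_faceVec p).symm⟩

theorem vertexVec_vecMul_incidence_zero [Fintype L.SourceQubit] (c : L.CellOfColor 0) :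
    L.vertexVec c.1 ᵥ* L.incidence = 0 :=
  funext fun e => L.vertexVec_vecMul_incidence_of_ne c (Fin.succ_ne_zero e.1)

theorem vertexVec_vecMul_incidence_succ [Fintype L.SourceQubit] {j : Fin d}
    (c : L.CellOfColor j.succ) :
    L.vertexVec c.1 ᵥ* L.incidence =
      sigmaSingle j fun e => ((L.shrunk j.succ).ends c e : ZMod 2) := by
  funext ⟨j', e⟩
  rcases eq_or_ne j' j with rfl | h
  · rw [vertexVec_vecMul_incidence, sigmaSingle, Pi.single_eq_same]
    rfl
  · rw [L.vertexVec_vecMul_incidence_of_ne c (fun h' => h (Fin.succ_injective d h')), sigmaSingle,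
      Pi.single_eq_of_ne h, Pi.zero_apply]

theorem sigmaSingle_sides {j : Fin d} (f : L.ShrunkFace j.succ) :
    sigmaSingle j (fun e => ((L.shrunk j.succ).sides f e : ZMod 2)) = L.faceVec ⟨j, f⟩ := by
  funext ⟨j', e⟩
  rcases eq_or_ne j' j with rfl | h
  · rw [sigmaSingle, Pi.single_eq_same]
    simp only [shrunk]
    by_cases he : e.1.1 ≤ f.1.1
    · have hmem : e ∈ {e : L.ShrunkEdge j'.succ | e.1.1 ≤ f.1.1} := he
      rw [Set.indicator_of_mem hmem, L.faceVec_apply_of_mem (e := ⟨j', e⟩) rfl he,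
        Pi.one_apply, Nat.cast_one]
    · have hmem : e ∉ {e : L.ShrunkEdge j'.succ | e.1.1 ≤ f.1.1} := he
      rw [Set.indicator_of_notMem hmem, Nat.cast_zero]
      exact (not_not.1 fun h => he (L.faceVec_ne_zero (e := ⟨j', e⟩) h).2).symm
  · rw [sigmaSingle, Pi.single_eq_of_ne h, Pi.zero_apply]
    exact (not_not.1 fun h' => h (L.faceVec_ne_zero h').1).symm

theorem iUnion_sigmaSingle_sides :
    (⋃ j, sigmaSingle j '' Set.range fun (f : L.ShrunkFace j.succ) e =>
      ((L.shrunk j.succ).sides f e : ZMod 2)) = Set.range L.faceVec := by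
  simp only [← Set.range_comp, Function.comp_def, sigmaSingle_sides,
    Set.range_sigma_eq_iUnion_range]

theorem span_sigmaSingle_ends [Fintype L.SourceQubit] :
    Submodule.span (ZMod 2) (⋃ j, sigmaSingle j '' Set.range
      fun (c : L.ShrunkVertex j.succ) e => ((L.shrunk j.succ).ends c e : ZMod 2)) =
      Submodule.span (ZMod 2)
        ((· ᵥ* L.incidence) '' Set.range fun c : L.CellOfDim d => L.vertexVec c.1) := by
  refine le_antisymm (Submodule.span_le.2 ?_) (Submodule.span_le.2 ?_)
  · refine Set.iUnion_subset fun j => ?_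
    rintro _ ⟨_, ⟨c, rfl⟩, rfl⟩
    rw [← vertexVec_vecMul_incidence_succ]
    exact Submodule.subset_span ⟨_, ⟨⟨c.1, c.2.1⟩, rfl⟩, rfl⟩
  · rintro _ ⟨_, ⟨⟨c, hc⟩, rfl⟩, rfl⟩
    obtain h | ⟨j, h⟩ := Fin.eq_zero_or_eq_succ (L.color c)
    · simp only [L.vertexVec_vecMul_incidence_zero ⟨c, hc, h⟩]
      exact zero_mem (Submodule.span _ _)
    · simp only [L.vertexVec_vecMul_incidence_succ ⟨c, hc, h⟩]
      exact Submodule.subset_span (Set.mem_iUnion.2 ⟨j, _, ⟨⟨c, hc, h⟩, rfl⟩, rfl⟩)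

section Finite

variable [Finite Cell]

theorem colorCode_eq_cssGroup :
    L.colorCode = cssGroup (Set.range fun c : L.CellOfDim d => (L.verticesOf c.1).indicator 1)
      (Set.range fun f : L.CellOfDim 2 => (L.verticesOf f.1).indicator 1) := by
  simp only [colorCode, cssGroup, pauliXOn_eq_xOp, pauliZOn_eq_zOp, ← Set.range_comp]
  rfl

theorem ancillaGroup_eq_cssGroup :
    L.ancillaGroup = cssGroup ∅ (Set.range fun a : L.Ancilla => Set.indicator {a} 1) := by
  simp only [ancillaGroup, cssGroup, pauliZOn_eq_zOp, ← Set.range_comp, Set.image_empty,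
    Set.empty_union]
  rfl

theorem groupTensor_colorCode_ancillaGroup [Fintype L.TargetQubit] :
    groupTensor L.colorCode L.ancillaGroup =
      Units.val '' (cssGroup (Set.range fun c : L.CellOfDim d => L.vertexVec c.1)
        (L.incidence.mulVec '' Set.range L.faceVec ∪
          (fun q => Set.indicator {q} 1) '' (Set.range Sum.inl)ᶜ) : Set (Op L.SourceQubit)ˣ) := by
  have hancilla (a : L.Ancilla) :
      Sum.elim (0 : L.CellOfDim 0 → ZMod 2) (Set.indicator {a} 1) =
        (Set.indicator {Sum.inr a} 1 : L.SourceQubit → ZMod 2) := by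
    classical
    funext q
    cases q <;> simp [Set.indicator_apply, Pi.single_apply]
  rw [colorCode_eq_cssGroup, ancillaGroup_eq_cssGroup, groupTensor_cssGroup, Set.image_empty,
    Set.union_empty, ← range_vertexVec_face, Set.compl_range_inl]
  simp only [← Set.range_comp, Function.comp_def, sumElim_indicator_verticesOf, hancilla]

theorem groupTensorFamily_toricCode [Fintype L.SourceQubit] :
    groupTensorFamily (fun j : Fin d => (L.shrunk j.succ).toricCode) =
      Units.val '' (cssGroup ((· ᵥ* L.incidence) '' Set.range fun c : L.CellOfDim d =>
        L.vertexVec c.1) (Set.range L.faceVec) : Set (Op L.TargetQubit)ˣ) := by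
  simp only [TwoComplex.toricCode_eq_cssGroup]
  rw [groupTensorFamily_cssGroup, iUnion_sigmaSingle_sides,
    cssGroup_congr_left L.span_sigmaSingle_ends]

/-- The edges that carry toric code qubits, as a graph on the vertices of the lattice. The `d`-cells
of color `C_0` cut it into connected parts, and the ancillas are the spare positions. -/
def rootedGraph [Fintype L.SourceQubit] (hd : 2 ≤ d) :
    RootedGraph (L.CellOfColor 0) L.SourceQubit L.TargetQubit where
  source := L.sourceRegion
  target := L.targetRegion
  existsUnique_source := L.existsUnique_mem_sourceRegion
  existsUnique_target := L.existsUnique_mem_targetRegion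
  card_source := L.ncard_sourceRegion hd
  vertices := Set.range Sum.inl
  root c := Sum.inl ⟨(L.exists_vertex c.1).choose, (L.exists_vertex c.1).choose_spec.2⟩
  root_mem_source c := L.inl_mem_sourceRegion_iff.2 (L.exists_vertex c.1).choose_spec.1
  root_mem_vertices c := ⟨_, rfl⟩
  incidence := L.incidence
  incidence_of_notMem_vertices := by
    rintro (v | a) h
    · exact absurd ⟨v, rfl⟩ h
    · exact L.incidence_inr a
  mem_source_iff_of_incidence_ne_zero := L.mem_sourceRegion_iff_of_incidence_ne_zero
  one_vecMul_incidence := L.one_vecMul_incidence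
  eq_root_of_vecMul_incidence_eq_zero := by
    rintro w c _ hw hc ⟨v, rfl⟩
    exact L.eq_of_vecMul_incidence_eq_zero hw (L.inl_mem_sourceRegion_iff.1 hc)
      (L.exists_vertex c.1).choose_spec.1

theorem spread_rootedGraph_mem_span [Fintype L.SourceQubit] (hd : 2 ≤ d)
    (w : L.SourceQubit → ZMod 2) : (L.rootedGraph hd).spread w ∈
      Submodule.span (ZMod 2) (Set.range fun c : L.CellOfDim d => L.vertexVec c.1) := by
  have h (c : L.CellOfColor 0) : Set.range Sum.inl ∩ L.sourceRegion c =
      Sum.inl '' L.verticesOf c.1 := by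
    refine Set.Subset.antisymm ?_ ?_
    · rintro _ ⟨⟨v, rfl⟩, hv⟩
      exact ⟨v, L.inl_mem_sourceRegion_iff.1 hv, rfl⟩
    · rintro _ ⟨v, hv, rfl⟩
      exact ⟨⟨v, rfl⟩, L.inl_mem_sourceRegion_iff.2 hv⟩
  refine Submodule.span_mono ?_ ((L.rootedGraph hd).spread_mem_span w)
  rintro _ ⟨c, rfl⟩
  exact ⟨⟨c.1, c.2.1⟩, congrArg (fun s : Set L.SourceQubit => s.indicator 1) (h c).symm⟩

end Finite

end ColoredLattice

end StabilizerGroups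

end

theorem theorem2 {Cell : Type*} [Finite Cell] [PartialOrder Cell] {d : ℕ} (hd : 2 ≤ d)
    (L : ColoredLattice Cell d) :
    ∃ (U : LinOp L.TargetQubit L.SourceQubit)
      (Uc : ∀ c : L.CellOfColor 0, LinOp (L.targetRegion c) (L.sourceRegion c)),
      IsClifford U ∧ (∀ c, IsClifford (Uc c)) ∧ U = regionTensor Uc ∧
      conjBy U (groupTensor L.colorCode L.ancillaGroup) =
        groupTensorFamily (fun j : Fin d => (L.shrunk j.succ).toricCode) := by
  have := Fintype.ofFinite L.SourceQubit
  have := Fintype.ofFinite L.TargetQubit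
  let G := L.rootedGraph hd
  have hvertices : ∀ a ∈ Set.range fun c : L.CellOfDim d => L.vertexVec c.1,
      ∀ q ∉ G.vertices, a q = 0 := by
    rintro _ ⟨c, rfl⟩ (v | a) hq
    · exact absurd ⟨v, rfl⟩ hq
    · exact L.vertexVec_inr c.1 a
  refine ⟨G.unfolding, G.unfoldingOn, G.isClifford_unfolding, G.isClifford_unfoldingOn,
    G.unfolding_eq_regionTensor, ?_⟩
  rw [L.groupTensor_colorCode_ancillaGroup, L.groupTensorFamily_toricCode,
    conjBy_image_val G.isClifford_unfolding.isUnitary]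
  exact congrArg
    (fun H : Subgroup (Op L.TargetQubit)ˣ => Units.val '' (H : Set (Op L.TargetQubit)ˣ))
    (G.map_unfolding_cssGroup hvertices (L.spread_rootedGraph_mem_span hd)
      fun _ => L.mem_span_faceVec)
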